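/- **Setting.** A single-armed MDP has a finite state space $\mathbb S$, actions $\{0,1\}$, transition probabilities $P(s,a,s')$ and rewards $r(s,a)\in\mathbb R$; put $r_{\max}=\max_{s,a}|r(s,a)|$. Let $0<\alpha<1$ and $\beta=\min\{\alpha,1-\alpha\}$. In the $N$-armed restless bandit problem ($N\ge 1$, $\alpha N$ an integer), $N$ copies (arms) of this MDP move independently given the states and actions, and at every time $t\ge 0$ exactly $\alpha N$ arms must receive action $1$. Policies may be randomized and history-dependent. From an initial state vector $\mathbf S_0\in\mathbb S^N$, with state $S_t(i)$ and action $A_t(i)$ of arm $i$ at time $t$, let $R^*(N,\mathbf S_0)$ be the supremum of $\liminf_{T\to\infty}\frac1T\sum_{t<T}\frac1N\sum_{i}\mathbb E[r(S_t(i),A_t(i))]$ over all policies satisfying the constraint, and write $R(\pi,\mathbf S_0)$ for the limit of the same averages under a policy $\pi$, when it exists. **LP and single-armed policy.** Let $y^*$ maximize $\sum_{s,a}r(s,a)y(s,a)$ over $y\ge 0$ with $\sum_s y(s,1)=\alpha$, $\sum_{s',a}y(s',a)P(s',a,s)=\sum_a y(s,a)$ for all $s$, and $\sum_{s,a}y(s,a)=1$.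 Put $\bar\pi^*(a|s)=y^*(s,a)/(y^*(s,0)+y^*(s,1))$ if the denominator is positive and $\bar\pi^*(a|s)=1/2$ otherwise, and $P_{\bar\pi^*}(s,s')=\sum_a\bar\pi^*(a|s)P(s,a,s')$. Assume that $P_{\bar\pi^*}$ is an aperiodic unichain (a single recurrent class, which is aperiodic, and possibly transient states), with stationary distribution $\mu^*$. **Set-expansion policy.** For $D\subseteq[N]$ let $m(D)=|D|/N$, let $X_t(D,s)=\frac1N|\{i\in D:S_t(i)=s\}|$, and let $\delta(X_t,D)=\beta(1-m(D))-\frac12\sum_s|X_t(D,s)-m(D)\mu^*(s)|$. Start with $D_{-1}=\emptyset$. At each time $t=0,1,2,\dots$: 1. If $\delta(X_t,D_{t-1})>0$, let $D_t$ be any set of the largest cardinality with $D_t\supseteq D_{t-1}$ and $\delta(X_t,D_t)\ge0$; otherwise let $D_t$ be any set of the largest cardinality with $D_t\subseteq D_{t-1}$ and $\delta(X_t,D_t)\ge 0$. (The choice may be randomized and is based on the states at time $t$ and on $D_{t-1}$ only.) 2. Independently sample ideal actions $\hat A_t(i)\sim\bar\pi^*(\cdot|S_t(i))$, $i\in[N]$.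 3. If $\sum_{i\in D_t}\hat A_t(i)\ge\alpha N$, select uniformly at random $\alpha N$ arms in $D_t$ with $\hat A_t(i)=1$, give them action $1$, and give all other arms action $0$. Else, if $\sum_{i\in D_t}\hat A_t(i)\le\alpha N-(N-|D_t|)$, select uniformly at random $(1-\alpha)N$ arms in $D_t$ with $\hat A_t(i)=0$, give them action $0$, and give all other arms action $1$. Else put $A_t(i)=\hat A_t(i)$ for $i\in D_t$ and, subject to the total budget $\alpha N$, for as many $i\notin D_t$ as possible, breaking ties uniformly at random. **Theorem.** Let $\Xi$ be the matrix all of whose rows are $\mu^*$. The series $W=\sum_{k\ge0}(P_{\bar\pi^*}-\Xi)^k(P_{\bar\pi^*}^\top-\Xi^\top)^k$ converges and $W$ has a largest eigenvalue $\lambda_W$. For every $N\ge1$ with $\alpha N$ an integer, every $\mathbf S_0$, and the set-expansion policy $\pi$ with any admissible choice of the sets $D_t$, the long-run average reward $R(\pi,\mathbf S_0)$ exists and $$R^*(N,\mathbf S_0)-R(\pi,\mathbf S_0)\le\frac{C_{\mathrm{SE}}}{\sqrt N},\qquad C_{\mathrm{SE}}=\frac{252\,r_{\max}\,\lambda_W^2\,|\mathbb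 S|^2}{\beta^2}.$$ In particular $C_{\mathrm{SE}}$ depends only on $r_{\max}$, $|\mathbb S|$, $\beta$ and $P_{\bar\pi^*}$. -/

import Mathlib

open Filter Topology
open scoped NNReal ENNReal BigOperators

noncomputable section

namespace RestlessBandit

/-! ### The single-armed MDP and the linear program -/

/-- A single-armed MDP with state space `S` and action space `{0, 1}`; the action `1` (pull the arm)
is `true`, the action `0` is `false`. -/
structure SingleArmedMDP (S : Type*) where
  /-- `P s a s'` is the probability of moving from `s` to `s'` under the action `a`. -/
  P : S → Bool → PMF S
  /-- the expected reward of the action `a` in the state `s` -/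
  r : S → Bool → ℝ

/-- `r_max`, the maximum of `|r s a|` over the finitely many pairs `(s, a)`. -/
def SingleArmedMDP.rmax {S : Type*} (M : SingleArmedMDP S) : ℝ :=
  ⨆ p : S × Bool, |M.r p.1 p.2|

section LinearProgram

variable {S : Type*} [Fintype S]

/-- The constraints of the linear program with budget `α`. Nonnegativity of `y` is in its type. -/
structure LPFeasible (M : SingleArmedMDP S) (α : ℝ) (y : S → Bool → ℝ≥0) : Prop where
  budget : ∑ s, (y s true : ℝ) = α
  flow : ∀ s, ∑ s', ∑ a, (y s' a : ℝ) * (M.P s' a s).toReal = ∑ a, (y s a : ℝ)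
  total : ∑ s, ∑ a, (y s a : ℝ) = 1

/-- The objective of the linear program. -/
def lpObjective (M : SingleArmedMDP S) (y : S → Bool → ℝ≥0) : ℝ :=
  ∑ s, ∑ a, M.r s a * (y s a : ℝ)

/-- `y` is an optimal solution of the linear program. -/
def LPOptimal (M : SingleArmedMDP S) (α : ℝ) (y : S → Bool → ℝ≥0) : Prop :=
  LPFeasible M α y ∧ ∀ z : S → Bool → ℝ≥0, LPFeasible M α z → lpObjective M z ≤ lpObjective M y

end LinearProgram

/-! ### The single-armed policy and its Markov chain -/

/-- The probability of the action `a` in the state `s` under the single-armed policy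
induced by `y`. -/
def armProb {S : Type*} (y : S → Bool → ℝ≥0) (s : S) (a : Bool) : ℝ≥0 :=
  if 0 < y s false + y s true then y s a / (y s false + y s true) else 1 / 2

theorem armProb_sum {S : Type*} (y : S → Bool → ℝ≥0) (s : S) :
    ∑ a, armProb y s a = 1 := by
  rw [Fintype.sum_bool]
  unfold armProb
  split_ifs with h
  · rw [← add_div, add_comm, div_self h.ne']
  · norm_num

/-- The single-armed policy induced by `y`, as a distribution on the actions for each state. -/
def armPolicy {S : Type*} (y : S → Bool → ℝ≥0) (s : S) : PMF Bool :=
  PMF.ofFintype (fun a => (armProb y s a : ℝ≥0∞)) (by exact_mod_cast armProb_sum y s)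

/-- The transition matrix of the single-armed MDP under the single-armed policy induced by `y`. -/
def armMatrix {S : Type*} (M : SingleArmedMDP S) (y : S → Bool → ℝ≥0) : Matrix S S ℝ :=
  Matrix.of fun s s' => ∑ a, (armProb y s a : ℝ) * (M.P s a s').toReal

section Chain

variable {S : Type*} [Fintype S] [DecidableEq S]

/-- The state `s'` is accessible from `s` (in zero or more steps). -/
def Accessible (Q : Matrix S S ℝ) (s s' : S) : Prop := ∃ n : ℕ, 0 < (Q ^ n) s s'

/-- A recurrent class of a chain on a finite state space: a nonempty set of mutually accessible
states that is closed, that is, from each of its states exactly its states are accessible. -/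
def IsRecurrentClass (Q : Matrix S S ℝ) (C : Set S) : Prop :=
  C.Nonempty ∧ ∀ s ∈ C, ∀ s', Accessible Q s s' ↔ s' ∈ C

/-- The greatest common divisor of the possible return times to `s` is `1`. -/
def IsAperiodicState (Q : Matrix S S ℝ) (s : S) : Prop :=
  ∀ d : ℕ, (∀ n : ℕ, 0 < n → 0 < (Q ^ n) s s → d ∣ n) → d = 1

/-- `Q` is an aperiodic unichain: it has a single recurrent class (the states outside of it are
transient), and that class is aperiodic. -/
def IsAperiodicUnichain (Q : Matrix S S ℝ) : Prop :=
  ∃ C : Set S, IsRecurrentClass Q C ∧ (∀ C' : Set S, IsRecurrentClass Q C' → C' = C) ∧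
    ∀ s ∈ C, IsAperiodicState Q s

/-- `μ` is a stationary distribution of `Q`. -/
structure IsStationaryDistribution (Q : Matrix S S ℝ) (μ : S → ℝ) : Prop where
  nonneg : ∀ s, 0 ≤ μ s
  total : ∑ s, μ s = 1
  stationary : ∀ s', ∑ s, μ s * Q s s' = μ s'

/-- The `k`-th term `(Q - Ξ)^k (Qᵀ - Ξᵀ)^k` of the series for `W`, where every row of `Ξ`
is `μ`. -/
def weightTerm (Q : Matrix S S ℝ) (μ : S → ℝ) (k : ℕ) : Matrix S S ℝ :=
  (Q - Matrix.of fun _ s' => μ s') ^ k *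
    (Q.transpose - (Matrix.of fun (_ : S) s' => μ s').transpose) ^ k

/-- The weight matrix `W`. -/
def weightMatrix (Q : Matrix S S ℝ) (μ : S → ℝ) : Matrix S S ℝ :=
  ∑' k : ℕ, weightTerm Q μ k

/-- `l` is the largest eigenvalue of `W`. -/
def IsMaxEigenvalue (W : Matrix S S ℝ) (l : ℝ) : Prop :=
  IsGreatest {x : ℝ | Module.End.HasEigenvalue (Matrix.toLin' W) x} l

end Chain

/-! ### The `N`-armed problem -/

/-- The law of a vector with independent entries, the `i`-th of which has the law `p i`. -/
def indepLaw {N : ℕ} {β : Type*} [Fintype β] (p : Fin N → PMF β) : PMF (Fin N → β) :=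
  PMF.ofFintype (fun x => ∏ i, p i (x i)) (by
    classical
    rw [← Fintype.piFinset_univ, ← Finset.prod_univ_sum]
    refine Finset.prod_eq_one fun i _ => ?_
    rw [← tsum_fintype (L := .unconditional _)]
    exact (p i).tsum_coe)

/-- The number of arms in `D` that the action vector `a` pulls. -/
def pulls {N : ℕ} (D : Finset (Fin N)) (a : Fin N → Bool) : ℕ :=
  (D.filter fun i => a i = true).card

/-- A randomized, history-dependent policy for the `N`-armed problem. It keeps a memory; at each
time it sees the current states of all arms and draws jointly the new memory and the action vector,
with a distribution that may depend on the memory and on the states. As the memory can be of any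
type, it can record the time and the whole history (states, actions and private randomization). -/
structure Policy (S : Type*) (N : ℕ) where
  Mem : Type
  init : Mem
  act : Mem → (Fin N → S) → PMF (Mem × (Fin N → Bool))

section Dynamics

variable {S : Type*} [Fintype S] {N : ℕ}

/-- The joint law of the memory before time `t` and the state vector at time `t`, from the initial
state vector `s₀`. Given states and actions, the arms move independently. -/
def stateLaw (M : SingleArmedMDP S) (π : Policy S N) (s₀ : Fin N → S) :
    ℕ → PMF (π.Mem × (Fin N → S))
  | 0 => PMF.pure (π.init, s₀)
  | t + 1 => (stateLaw M π s₀ t).bind fun x => (π.act x.1 x.2).bind fun z =>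
      (indepLaw fun i => M.P (x.2 i) (z.2 i)).map fun s' => (z.1, s')

/-- The joint law of the state vector and the action vector at time `t`. -/
def stateActionLaw (M : SingleArmedMDP S) (π : Policy S N) (s₀ : Fin N → S) (t : ℕ) :
    PMF ((Fin N → S) × (Fin N → Bool)) :=
  (stateLaw M π s₀ t).bind fun x => (π.act x.1 x.2).map fun z => (x.2, z.2)

/-- The budget constraint: at every time the policy pulls exactly `B` arms, almost surely. -/
def SatisfiesBudget (M : SingleArmedMDP S) (π : Policy S N) (s₀ : Fin N → S) (B : ℕ) : Prop :=
  ∀ t : ℕ, ∀ x ∈ (stateActionLaw M π s₀ t).support, pulls Finset.univ x.2 = B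

/-- The expected reward per arm at time `t`. -/
def expectedReward (M : SingleArmedMDP S) (π : Policy S N) (s₀ : Fin N → S) (t : ℕ) : ℝ :=
  ∑ s : Fin N → S, ∑ a : Fin N → Bool,
    (stateActionLaw M π s₀ t (s, a)).toReal * ((1 / (N : ℝ)) * ∑ i, M.r (s i) (a i))

/-- The expected reward per arm and time step over the first `T` time steps. -/
def averageReward (M : SingleArmedMDP S) (π : Policy S N) (s₀ : Fin N → S) (T : ℕ) : ℝ :=
  (1 / (T : ℝ)) * ∑ t ∈ Finset.range T, expectedReward M π s₀ t

/-- The liminf average reward. -/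
def liminfReward (M : SingleArmedMDP S) (π : Policy S N) (s₀ : Fin N → S) : ℝ :=
  liminf (averageReward M π s₀) atTop

/-- The optimal reward of the `N`-armed problem: the supremum of the liminf average rewards of all
policies that satisfy the budget constraint. -/
def optimalReward (M : SingleArmedMDP S) (N B : ℕ) (s₀ : Fin N → S) : ℝ :=
  sSup {x : ℝ | ∃ π : Policy S N, SatisfiesBudget M π s₀ B ∧ x = liminfReward M π s₀}

end Dynamics

/-! ### The set-expansion policy -/

section SetExpansion

variable {S : Type*} [Fintype S] [DecidableEq S] {N : ℕ}

/-- `m(D)`, the fraction of the arms that are in `D`. -/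
def frac (D : Finset (Fin N)) : ℝ := (D.card : ℝ) / N

/-- The scaled state-count vector on `D` for the state vector `s`. -/
def scaledCount (s : Fin N → S) (D : Finset (Fin N)) (x : S) : ℝ :=
  (1 / (N : ℝ)) * ((D.filter fun i => s i = x).card : ℝ)

/-- The slack of the set `D` at the state vector `s`. -/
def slack (α : ℝ) (μ : S → ℝ) (s : Fin N → S) (D : Finset (Fin N)) : ℝ :=
  min α (1 - α) * (1 - frac D) - 1 / 2 * ∑ x, |scaledCount s D x - frac D * μ x|

/-- `D` is a set of the largest cardinality that has the property `p`. -/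
def IsLargest (p : Finset (Fin N) → Prop) (D : Finset (Fin N)) : Prop :=
  p D ∧ ∀ E, p E → E.card ≤ D.card

/-- `D` is a possible new focus set when the state vector is `s` and the previous focus set
is `D'`. -/
def IsFocusUpdate (α : ℝ) (μ : S → ℝ) (s : Fin N → S) (D' D : Finset (Fin N)) : Prop :=
  (0 < slack α μ s D' → IsLargest (fun E => D' ⊆ E ∧ 0 ≤ slack α μ s E) D) ∧
  (slack α μ s D' ≤ 0 → IsLargest (fun E => E ⊆ D' ∧ 0 ≤ slack α μ s E) D)

/-- A rule for the set update: it chooses, possibly at random and depending on the state vector and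
on the previous focus set, one of the possible new focus sets. -/
structure FocusRule (S : Type*) [Fintype S] [DecidableEq S] (N : ℕ) (α : ℝ) (μ : S → ℝ) where
  choose : (Fin N → S) → Finset (Fin N) → PMF (Finset (Fin N))
  valid : ∀ s D', ∀ D ∈ (choose s D').support, IsFocusUpdate α μ s D' D

/-- The number of arms outside `D` at which the action vector `a` agrees with the ideal
actions `b`. -/
def agreeOutside (D : Finset (Fin N)) (b a : Fin N → Bool) : ℕ :=
  (Dᶜ.filter fun i => a i = b i).card

/-- The action vectors among which the action rectification chooses uniformly at random, for the
budget `B`, the focus set `D` and the ideal actions `b`. The three cases are: pull `B` arms of `D`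
with ideal action `1` and no other arm; leave `N - B` arms of `D` with ideal action `0` idle and
pull all other arms; follow the ideal actions in `D` and, subject to the budget, for as many arms
outside `D` as possible. -/
def rectifiedActions (B : ℕ) (D : Finset (Fin N)) (b : Fin N → Bool) :
    Finset (Fin N → Bool) :=
  if B ≤ pulls D b then
    Finset.univ.filter fun a => pulls Finset.univ a = B ∧
      ∀ i, a i = true → i ∈ D ∧ b i = true
  else if pulls D b + Dᶜ.card ≤ B then
    Finset.univ.filter fun a => pulls Finset.univ a = B ∧
      ∀ i, a i = false → i ∈ D ∧ b i = false
  else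
    Finset.univ.filter fun a => (pulls Finset.univ a = B ∧ ∀ i ∈ D, a i = b i) ∧
      ∀ a' : Fin N → Bool, (pulls Finset.univ a' = B ∧ ∀ i ∈ D, a' i = b i) →
        agreeOutside D b a' ≤ agreeOutside D b a

theorem pulls_mem (T : Finset (Fin N)) :
    pulls Finset.univ (fun i => decide (i ∈ T)) = T.card := by
  unfold pulls
  congr 1
  ext i
  simp

theorem rectifiedActions_nonempty {B : ℕ} (hB : B ≤ N) (D : Finset (Fin N))
    (b : Fin N → Bool) : (rectifiedActions B D b).Nonempty := by
  unfold rectifiedActions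
  split_ifs with h1 h2
  · obtain ⟨T, hT, hc⟩ := Finset.exists_subset_card_eq h1
    refine ⟨fun i => decide (i ∈ T), ?_⟩
    simp only [Finset.mem_filter, Finset.mem_univ, true_and, decide_eq_true_eq]
    refine ⟨by rw [pulls_mem, hc], fun i hi => ?_⟩
    simpa using hT hi
  · have hsum : (D.filter fun i => b i = true).card + (D.filter fun i => ¬ b i = true).card
        = D.card := Finset.card_filter_add_card_filter_not _
    have hD : D.card + Dᶜ.card = N := by simp
    have h3 : N - B ≤ (D.filter fun i => ¬ b i = true).card := by
      unfold pulls at h2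
      omega
    obtain ⟨T, hT, hc⟩ := Finset.exists_subset_card_eq h3
    refine ⟨fun i => decide (i ∈ Tᶜ), ?_⟩
    simp only [Finset.mem_filter, Finset.mem_univ, true_and, decide_eq_false_iff_not]
    refine ⟨?_, fun i hi => ?_⟩
    · rw [pulls_mem, Finset.card_compl, hc, Fintype.card_fin]
      omega
    · simpa using hT (by simpa using hi)
  · have hex : (Finset.univ.filter fun a : Fin N → Bool =>
        pulls Finset.univ a = B ∧ ∀ i ∈ D, a i = b i).Nonempty := by
      have h3 : B - pulls D b ≤ Dᶜ.card := by omega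
      obtain ⟨T, hT, hc⟩ := Finset.exists_subset_card_eq h3
      refine ⟨fun i => decide (i ∈ (D.filter fun i => b i = true) ∪ T), ?_⟩
      simp only [Finset.mem_filter, Finset.mem_univ, true_and]
      refine ⟨?_, fun i hi => ?_⟩
      · rw [pulls_mem, Finset.card_union_of_disjoint, hc]
        · unfold pulls at *
          omega
        · refine Finset.disjoint_left.2 fun i hi hi' => ?_
          have := hT hi'
          simp at this hi
          exact this hi.1
      · have hiT : i ∉ T := fun hi' => Finset.mem_compl.1 (hT hi') hi
        simp [hi, hiT]
    obtain ⟨a, ha, hmax⟩ := Finset.exists_max_image _ (agreeOutside D b) hex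
    refine ⟨a, ?_⟩
    simp only [Finset.mem_filter, Finset.mem_univ, true_and] at ha hmax ⊢
    exact ⟨ha, hmax⟩

/-- The set-expansion policy for the budget `B` with the set update `F`. Its memory is the previous
focus set, initially empty. At each time it updates the focus set, samples independent ideal actions
from the single-armed policy induced by `y`, and rectifies them. -/
def setExpansionPolicy {α : ℝ} {μ : S → ℝ} (y : S → Bool → ℝ≥0) {B : ℕ} (hB : B ≤ N)
    (F : FocusRule S N α μ) : Policy S N where
  Mem := Finset (Fin N)
  init := ∅
  act D' s := (F.choose s D').bind fun D =>
    (indepLaw fun i => armPolicy y (s i)).bind fun b =>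
      (PMF.uniformOfFinset (rectifiedActions B D b) (rectifiedActions_nonempty hB D b)).map
        fun a => (D, a)

end SetExpansion

/-- A budget `B = α N` with `α < 1` is at most the number of arms. -/
theorem budget_le {α : ℝ} {N B : ℕ} (hα : α < 1) (hB : (B : ℝ) = α * N) : B ≤ N := by
  have h : (B : ℝ) ≤ N := by
    rw [hB]
    exact mul_le_of_le_one_left (Nat.cast_nonneg N) hα.le
  exact_mod_cast h

end RestlessBandit

end

open RestlessBandit

/-! Both rewards are compared with the value of the linear program. It bounds the reward of every
policy because time-averaged state-action frequencies satisfy the budget exactly and the flow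
constraints up to `1/T`, so their limit points are feasible (`liminfReward_le_lpObjective`).

For the set-expansion policy, write `δ` for the slack, `m` for `frac`, `v` for the deviation of the
state counts on the focus set `D` from `m(D) μ`, `β = min α (1 - α)` and `λ` for the top eigenvalue
of `W`. Three facts carry the argument.

Nonnegative slack puts the expected number of ideal pulls in `D` inside the range that the budget
can serve. Hence only fluctuations force arms of `D` away from their ideal actions, at most `√N` of
them in expectation (`mean_mismatches_le`), and `v` moves as `v ↦ vP` up to an `ℓ¹` error of order
`1/√N` (`mean_deviation_sub_vecMul_le`).

The norm `h(v) = √(v W vᵀ)` contracts by the factor `1 - 1/(2λ)` under the chain on vectors of total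
mass zero (`exists_weightedNorm`).

Maximality of `D` makes the uncovered fraction `1 - m(D)` at most a multiple of `‖v‖₁` plus `O(1/N)`
(`IsFocusUpdate.coverage`), and a shrinking update removes little when the slack is only slightly
negative (`IsFocusUpdate.shrink_le`).

The Lyapunov function is `h(v) + 2√λ (1 - m(D)) + (4√λ/β) max(-δ, 0)`. The second term pays for the
growth of `h` when `D` expands, the third for the loss when `D` shrinks. One step thus decreases it
in expectation by at least `h(v)/(2λ)`, up to `O(1/√N)`. The loss of reward is at most a multiple of
`1 - m(D)`, hence of `h(v)`, plus `O(1/√N)`; so the drift controls it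
(`IsFocusUpdate.lpObjective_sub_le`), and summing over time telescopes (`sub_le_of_drift`). The
average reward converges because the previous focus set and the state vector form a finite Markov
chain, to which the mean ergodic theorem applies. -/

namespace RestlessBandit

/-! ### Expectations under finitely supported laws -/

/-- The expectation of `f` under the law `p` on a finite type. -/
noncomputable def mean {α : Type*} [Fintype α] (p : PMF α) (f : α → ℝ) : ℝ :=
  ∑ x, (p x).toReal * f x

section Mean

variable {α β : Type*} [Fintype α] [Fintype β]

theorem sum_toReal_eq_one (p : PMF α) : ∑ x, (p x).toReal = 1 := by
  rw [← ENNReal.toReal_sum fun x _ => p.apply_ne_top x, ← tsum_fintype (L := .unconditional _),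
    p.tsum_coe, ENNReal.toReal_one]

theorem mean_const (p : PMF α) (c : ℝ) : mean p (fun _ => c) = c := by
  rw [mean, ← Finset.sum_mul, sum_toReal_eq_one, one_mul]

theorem mean_add (p : PMF α) (f g : α → ℝ) :
    mean p (fun x => f x + g x) = mean p f + mean p g := by
  simp [mean, mul_add, Finset.sum_add_distrib]

theorem mean_sub (p : PMF α) (f g : α → ℝ) :
    mean p (fun x => f x - g x) = mean p f - mean p g := by
  simp [mean, mul_sub, Finset.sum_sub_distrib]

theorem mean_const_mul (p : PMF α) (c : ℝ) (f : α → ℝ) :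
    mean p (fun x => c * f x) = c * mean p f := by
  simp only [mean, Finset.mul_sum]
  exact Finset.sum_congr rfl fun x _ => by ring

theorem mean_sum {ι : Type*} (p : PMF α) (s : Finset ι) (f : ι → α → ℝ) :
    mean p (fun x => ∑ i ∈ s, f i x) = ∑ i ∈ s, mean p (f i) := by
  simp only [mean, Finset.mul_sum]
  exact Finset.sum_comm

theorem mean_congr {p : PMF α} {f g : α → ℝ} (h : ∀ x ∈ p.support, f x = g x) :
    mean p f = mean p g := by
  refine Finset.sum_congr rfl fun x _ => ?_
  by_cases hx : x ∈ p.support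
  · rw [h x hx]
  · rw [(p.apply_eq_zero_iff x).2 hx]
    simp

theorem mean_mono {p : PMF α} {f g : α → ℝ} (h : ∀ x ∈ p.support, f x ≤ g x) :
    mean p f ≤ mean p g := by
  refine Finset.sum_le_sum fun x _ => ?_
  by_cases hx : x ∈ p.support
  · exact mul_le_mul_of_nonneg_left (h x hx) ENNReal.toReal_nonneg
  · rw [(p.apply_eq_zero_iff x).2 hx]
    simp

theorem mean_le_of_forall {p : PMF α} {f : α → ℝ} {c : ℝ} (h : ∀ x ∈ p.support, f x ≤ c) :
    mean p f ≤ c :=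
  (mean_mono h).trans_eq (mean_const p c)

theorem le_mean_of_forall {p : PMF α} {f : α → ℝ} {c : ℝ} (h : ∀ x ∈ p.support, c ≤ f x) :
    c ≤ mean p f :=
  (mean_const p c).symm.trans_le (mean_mono h)

theorem abs_mean_le (p : PMF α) (f : α → ℝ) : |mean p f| ≤ mean p fun x => |f x| := by
  refine (Finset.abs_sum_le_sum_abs _ _).trans_eq (Finset.sum_congr rfl fun x _ => ?_)
  rw [abs_mul, abs_of_nonneg ENNReal.toReal_nonneg]

theorem mean_pure (x : α) (f : α → ℝ) : mean (PMF.pure x) f = f x := by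
  classical
  rw [mean, Finset.sum_eq_single x]
  · simp
  · intro y _ hy
    simp [PMF.pure_apply, hy]
  · simp

theorem mean_bind (p : PMF α) (k : α → PMF β) (f : β → ℝ) :
    mean (p.bind k) f = mean p fun x => mean (k x) f := by
  have h : ∀ y, (p.bind k y).toReal = ∑ x, (p x).toReal * (k x y).toReal := fun y => by
    rw [PMF.bind_apply, tsum_fintype, ENNReal.toReal_sum
      fun x _ => ENNReal.mul_ne_top (p.apply_ne_top x) ((k x).apply_ne_top y)]
    simp
  simp only [mean, h, Finset.sum_mul, Finset.mul_sum]
  rw [Finset.sum_comm]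
  simp [mul_assoc]

theorem mean_map (p : PMF α) (g : α → β) (f : β → ℝ) :
    mean (p.map g) f = mean p fun x => f (g x) := by
  rw [← PMF.bind_pure_comp, mean_bind]
  simp [mean_pure]

theorem sq_mean_le (p : PMF α) (f : α → ℝ) : mean p f ^ 2 ≤ mean p fun x => f x ^ 2 := by
  have h : 0 ≤ mean p fun x => (f x - mean p f) ^ 2 := le_mean_of_forall fun x _ => sq_nonneg _
  have h2 : (mean p fun x => (f x - mean p f) ^ 2)
      = (mean p fun x => f x ^ 2) - mean p f ^ 2 := by
    have h3 : ∀ x, (f x - mean p f) ^ 2 = f x ^ 2 - (2 * mean p f) * f x + mean p f ^ 2 :=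
      fun x => by ring
    simp only [h3]
    rw [mean_add, mean_sub, mean_const_mul, mean_const]
    ring
  linarith

theorem mean_abs_le_sqrt (p : PMF α) (f : α → ℝ) :
    (mean p fun x => |f x|) ≤ Real.sqrt (mean p fun x => f x ^ 2) := by
  refine Real.le_sqrt_of_sq_le ?_
  simpa using sq_mean_le p fun x => |f x|

theorem indepLaw_toReal {N : ℕ} (p : Fin N → PMF β) (x : Fin N → β) :
    (indepLaw p x).toReal = ∏ i, (p i (x i)).toReal := by
  simp [indepLaw, ENNReal.toReal_prod]

theorem mean_indepLaw_prod {N : ℕ} (p : Fin N → PMF β) (g : Fin N → β → ℝ) :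
    mean (indepLaw p) (fun x => ∏ i, g i (x i)) = ∏ i, mean (p i) (g i) := by
  classical
  simp only [mean, indepLaw_toReal, ← Finset.prod_mul_distrib]
  rw [Finset.prod_univ_sum, Fintype.piFinset_univ]

theorem mean_indepLaw_apply {N : ℕ} (p : Fin N → PMF β) (i : Fin N) (f : β → ℝ) :
    mean (indepLaw p) (fun x => f (x i)) = mean (p i) f := by
  have h := mean_indepLaw_prod p fun j => if j = i then f else fun _ => 1
  have h1 : ∀ x : Fin N → β, (∏ j, (if j = i then f else fun _ => 1) (x j)) = f (x i) :=
    fun x => by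
      rw [Finset.prod_eq_single i] <;> simp +contextual
  rw [Finset.prod_eq_single i] at h
  · simpa only [h1, if_true] using h
  · intro j _ hj
    simp only [hj, if_false]
    exact mean_const _ _
  · simp

theorem mean_indepLaw_mul {N : ℕ} (p : Fin N → PMF β) {i j : Fin N} (hij : i ≠ j)
    (f g : β → ℝ) :
    mean (indepLaw p) (fun x => f (x i) * g (x j)) = mean (p i) f * mean (p j) g := by
  have h := mean_indepLaw_prod p fun k => if k = i then f else if k = j then g else fun _ => 1
  have h1 : ∀ x : Fin N → β,
      (∏ k, (if k = i then f else if k = j then g else fun _ => 1) (x k)) = f (x i) * g (x j) :=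
    fun x => by
      rw [Finset.prod_eq_mul i j hij] <;> simp +contextual [hij.symm]
  rw [Finset.prod_eq_mul i j hij] at h
  · simpa only [h1, if_true, hij.symm, if_false] using h
  · intro k _ hk
    simp only [hk.1, hk.2, if_false]
    exact mean_const _ _
  · simp
  · simp

/-- The variance of a sum of independent variables is at most the sum of the second moments. -/
theorem mean_indepLaw_sq_sum_le {N : ℕ} (p : Fin N → PMF β) (D : Finset (Fin N))
    (f : Fin N → β → ℝ) :
    (mean (indepLaw p) fun x => (∑ i ∈ D, (f i (x i) - mean (p i) (f i))) ^ 2)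
      ≤ ∑ i ∈ D, mean (p i) fun z => f i z ^ 2 := by
  have h0 : ∀ i, mean (p i) (fun z => f i z - mean (p i) (f i)) = 0 := fun i => by
    rw [mean_sub, mean_const, sub_self]
  simp only [sq, Finset.sum_mul_sum, mean_sum]
  refine Finset.sum_le_sum fun i hi => ?_
  -- By independence the centred cross terms vanish; only the diagonal remains.
  rw [Finset.sum_eq_single i]
  · rw [mean_indepLaw_apply p i fun z => (f i z - mean (p i) (f i)) * (f i z - mean (p i) (f i))]
    have h3 : ∀ z, (f i z - mean (p i) (f i)) * (f i z - mean (p i) (f i))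
        = f i z * f i z - (2 * mean (p i) (f i)) * f i z + mean (p i) (f i) ^ 2 :=
      fun z => by ring
    simp only [h3]
    rw [mean_add, mean_sub, mean_const_mul, mean_const]
    nlinarith [sq_nonneg (mean (p i) (f i))]
  · intro j _ hj
    rw [mean_indepLaw_mul p hj.symm (fun z => f i z - mean (p i) (f i))
      fun z => f j z - mean (p j) (f j), h0, zero_mul]
  · exact fun h => absurd hi h

/-- A sum of independent variables with values in `[-1, 1]` deviates from its mean by at most
the square root of the number of terms, in expectation. -/
theorem mean_indepLaw_abs_sum_le {N : ℕ} (p : Fin N → PMF β) (D : Finset (Fin N))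
    (f : Fin N → β → ℝ) (hf : ∀ i z, |f i z| ≤ 1) :
    (mean (indepLaw p) fun x => |∑ i ∈ D, (f i (x i) - mean (p i) (f i))|) ≤ Real.sqrt N := by
  refine (mean_abs_le_sqrt _ _).trans (Real.sqrt_le_sqrt ?_)
  refine (mean_indepLaw_sq_sum_le p D f).trans ?_
  calc ∑ i ∈ D, mean (p i) (fun z => f i z ^ 2) ≤ ∑ i ∈ D, (1 : ℝ) :=
        Finset.sum_le_sum fun i _ => mean_le_of_forall fun z _ => by
          rw [← sq_abs]
          exact pow_le_one₀ (abs_nonneg _) (hf i z)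
    _ ≤ N := by
        rw [Finset.sum_const, nsmul_eq_mul, mul_one]
        exact_mod_cast (Finset.card_le_univ D).trans_eq (Fintype.card_fin N)

end Mean

/-! ### Ergodicity of aperiodic unichains -/

section Ergodicity

variable {S : Type*} [Fintype S] [DecidableEq S] {Q : Matrix S S ℝ}

theorem pow_add_pos (hQ : Q ∈ Matrix.rowStochastic ℝ S) {m n : ℕ} {s t u : S}
    (h1 : 0 < (Q ^ m) s t) (h2 : 0 < (Q ^ n) t u) : 0 < (Q ^ (m + n)) s u := by
  rw [pow_add, Matrix.mul_apply]
  refine (mul_pos h1 h2).trans_le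
    (Finset.single_le_sum (f := fun t => (Q ^ m) s t * (Q ^ n) t u) (fun v _ => ?_)
      (Finset.mem_univ t))
  exact mul_nonneg (Matrix.nonneg_of_mem_rowStochastic (pow_mem hQ m))
    (Matrix.nonneg_of_mem_rowStochastic (pow_mem hQ n))

theorem Accessible.trans (hQ : Q ∈ Matrix.rowStochastic ℝ S) {s t u : S}
    (h1 : Accessible Q s t) (h2 : Accessible Q t u) : Accessible Q s u := by
  obtain ⟨m, hm⟩ := h1
  obtain ⟨n, hn⟩ := h2
  exact ⟨m + n, pow_add_pos hQ hm hn⟩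

theorem Accessible.refl (s : S) : Accessible Q s s := ⟨0, by simp⟩

/-- A recurrent class is accessible from every state. -/
theorem exists_isRecurrentClass_accessible (hQ : Q ∈ Matrix.rowStochastic ℝ S) (s : S) :
    ∃ C : Set S, IsRecurrentClass Q C ∧ ∀ t ∈ C, Accessible Q s t := by
  classical
  -- Among the states accessible from `s`, `t` reaches the fewest states. Every state reached from
  -- `t` then reaches exactly the same set, so that set is a recurrent class.
  obtain ⟨t, ht, hmin⟩ := Set.exists_min_image {t | Accessible Q s t}
    (fun t => (Finset.univ.filter fun u => Accessible Q t u).card) (Set.toFinite _)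
    ⟨s, Accessible.refl s⟩
  refine ⟨{u | Accessible Q t u}, ⟨⟨t, Accessible.refl t⟩, fun u hu v => ?_⟩,
    fun u hu => Accessible.trans hQ ht hu⟩
  refine ⟨fun h => Accessible.trans hQ hu h, fun h => ?_⟩
  have hsub : (Finset.univ.filter fun w => Accessible Q u w)
      ⊆ Finset.univ.filter fun w => Accessible Q t w := fun w hw => by
    simp only [Finset.mem_filter, Finset.mem_univ, true_and] at hw ⊢
    exact Accessible.trans hQ hu hw
  have heq := Finset.eq_of_subset_of_card_le hsub (hmin u (Accessible.trans hQ ht hu))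
  have hv : v ∈ Finset.univ.filter fun w => Accessible Q t w := by simpa using h
  rw [← heq] at hv
  simpa using hv

/-- Some power of an aperiodic unichain has a positive column. -/
theorem exists_pow_pos_column (hQ : Q ∈ Matrix.rowStochastic ℝ S) (hchain : IsAperiodicUnichain Q) :
    ∃ n : ℕ, 0 < n ∧ ∃ s₀ : S, ∀ s, 0 < (Q ^ n) s s₀ := by
  obtain ⟨C, hC, huniq, haper⟩ := hchain
  obtain ⟨s₀, hs₀⟩ := hC.1
  -- Return times are closed under addition and have gcd `1`, so every large integer is a return
  -- time.
  set R : Set ℕ := {n | 0 < n ∧ 0 < (Q ^ n) s₀ s₀} with hR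
  have hgcd : Nat.setGcd R = 1 :=
    haper s₀ hs₀ _ fun n hn hp => Nat.setGcd_dvd_of_mem (show n ∈ R from ⟨hn, hp⟩)
  obtain ⟨n₀, hn₀⟩ := Nat.exists_mem_closure_of_ge R
  have hpos : ∀ m ≥ n₀, 0 < (Q ^ m) s₀ s₀ := fun m hm => by
    have hmem := hn₀ m hm (by rw [hgcd]; exact one_dvd m)
    clear hm
    induction hmem using AddSubmonoid.closure_induction with
    | mem x hx => exact hx.2
    | zero => simp
    | add x y _ _ hx hy => exact pow_add_pos hQ hx hy
  have hacc : ∀ s, ∃ n, 0 < (Q ^ n) s s₀ := fun s => by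
    obtain ⟨C', hC', h⟩ := exists_isRecurrentClass_accessible hQ s
    rw [huniq C' hC'] at h
    exact h s₀ hs₀
  choose k hk using hacc
  -- One exponent must serve all `s`: after reaching `s₀` in `k s` steps, the remaining time, at
  -- least `n₀`, is spent on a return to `s₀`. The `+ 1` makes the exponent positive.
  refine ⟨(∑ s, k s) + n₀ + 1, by omega, s₀, fun s => ?_⟩
  have hle : k s ≤ ∑ s, k s := Finset.single_le_sum (fun _ _ => Nat.zero_le _) (Finset.mem_univ s)
  have h := pow_add_pos hQ (hk s) (hpos (∑ s, k s - k s + n₀ + 1) (by omega))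
  rwa [show k s + (∑ s, k s - k s + n₀ + 1) = (∑ s, k s) + n₀ + 1 by omega] at h

theorem sum_vecMul (hQ : Q ∈ Matrix.rowStochastic ℝ S) (v : S → ℝ) :
    ∑ u, Matrix.vecMul v Q u = ∑ s, v s := by
  simp only [Matrix.vecMul, dotProduct]
  rw [Finset.sum_comm]
  simp [← Finset.mul_sum, Matrix.sum_row_of_mem_rowStochastic hQ]

/-- Dobrushin's contraction for a stochastic matrix with a column bounded below. -/
theorem sum_abs_vecMul_le (hQ : Q ∈ Matrix.rowStochastic ℝ S) {ε : ℝ} {s₀ : S}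
    (hε : ∀ s, ε ≤ Q s s₀) {v : S → ℝ} (hv : ∑ s, v s = 0) :
    ∑ u, |Matrix.vecMul v Q u| ≤ (1 - ε) * ∑ s, |v s| := by
  -- Subtracting `ε` from column `s₀` is invisible to a vector of mass zero, and leaves a
  -- nonnegative matrix with row sums `1 - ε`.
  have h1 : ∀ u, Matrix.vecMul v Q u = ∑ s, v s * (Q s u - if u = s₀ then ε else 0) := fun u => by
    simp only [Matrix.vecMul, dotProduct, mul_sub, Finset.sum_sub_distrib, ← Finset.sum_mul, hv,
      zero_mul, sub_zero]
  have h2 : ∀ s u, 0 ≤ Q s u - if u = s₀ then ε else 0 := fun s u => by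
    split_ifs with h
    · rw [h]
      exact sub_nonneg.2 (hε s)
    · rw [sub_zero]
      exact Matrix.nonneg_of_mem_rowStochastic hQ
  calc ∑ u, |Matrix.vecMul v Q u|
      ≤ ∑ u, ∑ s, |v s| * (Q s u - if u = s₀ then ε else 0) := by
        refine Finset.sum_le_sum fun u _ => ?_
        rw [h1]
        refine (Finset.abs_sum_le_sum_abs _ _).trans_eq (Finset.sum_congr rfl fun s _ => ?_)
        rw [abs_mul, abs_of_nonneg (h2 s u)]
    _ = (1 - ε) * ∑ s, |v s| := by
        rw [Finset.sum_comm, Finset.mul_sum]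
        refine Finset.sum_congr rfl fun s _ => ?_
        rw [← Finset.mul_sum, Finset.sum_sub_distrib, Matrix.sum_row_of_mem_rowStochastic hQ]
        simp [mul_comm]

theorem sum_abs_vecMul_le_sum_abs (hQ : Q ∈ Matrix.rowStochastic ℝ S) {v : S → ℝ}
    (hv : ∑ s, v s = 0) : ∑ u, |Matrix.vecMul v Q u| ≤ ∑ s, |v s| := by
  rcases isEmpty_or_nonempty S with h | ⟨⟨s₀⟩⟩
  · simp
  · simpa using sum_abs_vecMul_le hQ (ε := 0) (s₀ := s₀)
      (fun s => Matrix.nonneg_of_mem_rowStochastic hQ) hv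

/-- Geometric decay of mean-zero vectors under an aperiodic unichain. -/
theorem exists_sum_abs_vecMul_pow_le (hQ : Q ∈ Matrix.rowStochastic ℝ S)
    (hchain : IsAperiodicUnichain Q) :
    ∃ n : ℕ, 0 < n ∧ ∃ c : ℝ, 0 ≤ c ∧ c < 1 ∧ ∀ v : S → ℝ, ∑ s, v s = 0 → ∀ k : ℕ,
      ∑ u, |Matrix.vecMul v (Q ^ k) u| ≤ c ^ (k / n) * ∑ s, |v s| := by
  obtain ⟨n, hn, s₀, hpos⟩ := exists_pow_pos_column hQ hchain
  have : Nonempty S := ⟨s₀⟩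
  obtain ⟨s₁, hs₁⟩ := Finite.exists_min fun s => (Q ^ n) s s₀
  refine ⟨n, hn, 1 - (Q ^ n) s₁ s₀,
    sub_nonneg.2 (Matrix.le_one_of_mem_rowStochastic (pow_mem hQ n)), by linarith [hpos s₁],
    fun v hv k => ?_⟩
  have hblock : ∀ j, ∑ u, |Matrix.vecMul v (Q ^ (n * j)) u|
      ≤ (1 - (Q ^ n) s₁ s₀) ^ j * ∑ s, |v s| := fun j => by
    induction j with
    | zero => simp
    | succ j ih =>
      rw [mul_add, mul_one, pow_add, ← Matrix.vecMul_vecMul, pow_succ', mul_assoc]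
      refine (sum_abs_vecMul_le (pow_mem hQ n) hs₁ ?_).trans
        (mul_le_mul_of_nonneg_left ih
          (sub_nonneg.2 (Matrix.le_one_of_mem_rowStochastic (pow_mem hQ n))))
      rw [sum_vecMul (pow_mem hQ _), hv]
  -- Each full block of `n` steps contracts; the remaining `k % n` steps do not expand.
  have hk : Q ^ k = Q ^ (n * (k / n)) * Q ^ (k % n) := by rw [← pow_add, Nat.div_add_mod]
  rw [hk, ← Matrix.vecMul_vecMul]
  refine (sum_abs_vecMul_le_sum_abs (pow_mem hQ _) ?_).trans (hblock _)
  rw [sum_vecMul (pow_mem hQ _), hv]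

/-- Division with remainder turns the series into a geometric series repeated `n` times. -/
theorem summable_pow_div {c : ℝ} (h0 : 0 ≤ c) (h1 : c < 1) {n : ℕ} (hn : 0 < n) :
    Summable fun k : ℕ => c ^ (k / n) := by
  have : NeZero n := ⟨hn.ne'⟩
  have h : Summable fun p : ℕ × Fin n => c ^ p.1 * (fun _ : Fin n => (1 : ℝ)) p.2 :=
    (summable_geometric_of_lt_one h0 h1).mul_of_nonneg (Summable.of_finite)
      (fun k => pow_nonneg h0 k) fun _ => zero_le_one
  have h2 := (Nat.divModEquiv n).summable_iff.2 h
  simpa [Function.comp_def] using h2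

/-- An aperiodic unichain has at most one stationary distribution. -/
theorem IsStationaryDistribution.unique (hQ : Q ∈ Matrix.rowStochastic ℝ S)
    (hchain : IsAperiodicUnichain Q) {μ ν : S → ℝ} (hμ : IsStationaryDistribution Q μ)
    (hν : IsStationaryDistribution Q ν) : μ = ν := by
  obtain ⟨n, hn, c, hc0, hc1, h⟩ := exists_sum_abs_vecMul_pow_le hQ hchain
  have hinv : ∀ {ρ : S → ℝ}, IsStationaryDistribution Q ρ → Matrix.vecMul ρ Q = ρ :=
    fun {ρ} hρ => funext fun s => by simpa [Matrix.vecMul, dotProduct] using hρ.stationary s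
  have hpow : ∀ {ρ : S → ℝ}, IsStationaryDistribution Q ρ → ∀ k, Matrix.vecMul ρ (Q ^ k) = ρ :=
    fun {ρ} hρ k => by
      induction k with
      | zero => simp
      | succ k ih => rw [pow_succ, ← Matrix.vecMul_vecMul, ih, hinv hρ]
  -- The difference has mass zero and is fixed by `Q ^ n`, which contracts it by `c < 1`.
  have h1 := h (μ - ν) (by simp [hμ.total, hν.total]) n
  rw [Matrix.sub_vecMul, hpow hμ, hpow hν, Nat.div_self hn, pow_one] at h1
  have h2 : ∑ s, |(μ - ν) s| = 0 := by
    have h3 : 0 ≤ ∑ s, |(μ - ν) s| := Finset.sum_nonneg fun _ _ => abs_nonneg _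
    nlinarith
  rw [Finset.sum_eq_zero_iff_of_nonneg fun _ _ => abs_nonneg _] at h2
  funext s
  exact sub_eq_zero.1 (abs_eq_zero.1 (h2 s (Finset.mem_univ s)))

-- The matrix with all rows `μ` annihilates vectors of mass zero, so on them the series for `W`,
-- built from `Q - Ξ`, sees only `Q`.
omit [DecidableEq S] in
theorem vecMul_sub_stationary (μ : S → ℝ) {v : S → ℝ} (hv : ∑ s, v s = 0) :
    Matrix.vecMul v (Q - Matrix.of fun (_ : S) s' => μ s') = Matrix.vecMul v Q := by
  funext u
  simp [Matrix.vecMul, dotProduct, mul_sub, ← Finset.sum_mul, hv]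

theorem vecMul_sub_stationary_pow (hQ : Q ∈ Matrix.rowStochastic ℝ S) (μ : S → ℝ) {v : S → ℝ}
    (hv : ∑ s, v s = 0) (k : ℕ) :
    Matrix.vecMul v ((Q - Matrix.of fun (_ : S) s' => μ s') ^ k) = Matrix.vecMul v (Q ^ k) := by
  induction k with
  | zero => simp
  | succ k ih =>
    rw [pow_succ, ← Matrix.vecMul_vecMul, ih, vecMul_sub_stationary, Matrix.vecMul_vecMul, pow_succ]
    rw [sum_vecMul (pow_mem hQ _), hv]

/-- As `μ (Q - Ξ) = 0`, for `k ≥ 1` row `s` of the power is `(e_s - μ) Q ^ k`, to which the decay on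
mass-zero vectors applies; the factor `2` bounds `‖e_s - μ‖₁`. At `k = 0` the vector `μ` is not
annihilated, hence the separate case. -/
theorem abs_sub_stationary_pow_le (hQ : Q ∈ Matrix.rowStochastic ℝ S) {μ : S → ℝ}
    (hμ : IsStationaryDistribution Q μ) {n : ℕ} {c : ℝ} (hc0 : 0 ≤ c)
    (h : ∀ v : S → ℝ, ∑ s, v s = 0 → ∀ k : ℕ,
      ∑ u, |Matrix.vecMul v (Q ^ k) u| ≤ c ^ (k / n) * ∑ s, |v s|) (k : ℕ) (s u : S) :
    |((Q - Matrix.of fun (_ : S) s' => μ s') ^ k) s u| ≤ 2 * c ^ (k / n) := by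
  have hsingle : ∑ t, (Pi.single s 1 - μ : S → ℝ) t = 0 := by
    simp [hμ.total]
  rcases Nat.eq_zero_or_pos k with rfl | hk
  · simp only [pow_zero, Nat.zero_div, mul_one, Matrix.one_apply]
    split_ifs <;> norm_num
  have hrow : ((Q - Matrix.of fun (_ : S) s' => μ s') ^ k) s u
      = Matrix.vecMul (Pi.single s 1 - μ) (Q ^ k) u := by
    rw [← vecMul_sub_stationary_pow hQ μ hsingle, Matrix.sub_vecMul]
    have hzero : Matrix.vecMul μ ((Q - Matrix.of fun (_ : S) s' => μ s') ^ k) = 0 := by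
      obtain ⟨j, rfl⟩ : ∃ j, k = j + 1 := ⟨k - 1, by omega⟩
      rw [pow_succ', ← Matrix.vecMul_vecMul]
      have : Matrix.vecMul μ (Q - Matrix.of fun (_ : S) s' => μ s') = 0 := by
        funext t
        simp [Matrix.vecMul, dotProduct, mul_sub, ← Finset.sum_mul, hμ.total, hμ.stationary]
      rw [this, Matrix.zero_vecMul]
    rw [hzero, sub_zero, Matrix.single_one_vecMul]
    rfl
  rw [hrow]
  refine (Finset.single_le_sum (f := fun u => |Matrix.vecMul (Pi.single s 1 - μ) (Q ^ k) u|)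
    (fun _ _ => abs_nonneg _) (Finset.mem_univ u)).trans ((h _ hsingle k).trans ?_)
  rw [mul_comm]
  refine mul_le_mul_of_nonneg_right ?_ (pow_nonneg hc0 _)
  calc ∑ t, |(Pi.single s 1 - μ : S → ℝ) t| ≤ ∑ t, (|(Pi.single s 1 : S → ℝ) t| + |μ t|) :=
        Finset.sum_le_sum fun t _ => abs_sub _ _
    _ = 2 := by
        rw [Finset.sum_add_distrib]
        have h1 : ∑ t, |μ t| = 1 := by
          rw [← hμ.total]
          exact Finset.sum_congr rfl fun t _ => abs_of_nonneg (hμ.nonneg t)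
        have h2 : ∑ t, |(Pi.single s 1 : S → ℝ) t| = 1 := by
          rw [Finset.sum_eq_single s] <;> simp +contextual
        rw [h1, h2]
        norm_num

theorem summable_weightTerm (hQ : Q ∈ Matrix.rowStochastic ℝ S) (hchain : IsAperiodicUnichain Q)
    {μ : S → ℝ} (hμ : IsStationaryDistribution Q μ) : Summable (weightTerm Q μ) := by
  obtain ⟨n, hn, c, hc0, hc1, h⟩ := exists_sum_abs_vecMul_pow_le hQ hchain
  have hA := abs_sub_stationary_pow_le hQ hμ hc0 h
  refine Pi.summable.2 fun s => Pi.summable.2 fun s' => ?_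
  refine Summable.of_norm_bounded (g := fun k : ℕ => (4 * Fintype.card S : ℝ) * c ^ (k / n))
    ((summable_pow_div hc0 hc1 hn).mul_left _) fun k => ?_
  rw [weightTerm, ← Matrix.transpose_sub, ← Matrix.transpose_pow, Matrix.mul_apply, Real.norm_eq_abs]
  have hle : c ^ (k / n) ≤ 1 := pow_le_one₀ hc0 hc1.le
  have h0 : 0 ≤ c ^ (k / n) := pow_nonneg hc0 _
  calc _ ≤ ∑ _u : S, 4 * c ^ (k / n) := by
        refine (Finset.abs_sum_le_sum_abs _ _).trans (Finset.sum_le_sum fun u _ => ?_)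
        rw [abs_mul, Matrix.transpose_apply]
        calc _ ≤ (2 * c ^ (k / n)) * (2 * c ^ (k / n)) :=
              mul_le_mul (hA k s u) (hA k s' u) (abs_nonneg _) (by positivity)
          _ ≤ 4 * c ^ (k / n) := by nlinarith
    _ = (4 * Fintype.card S : ℝ) * c ^ (k / n) := by
        rw [Finset.sum_const, nsmul_eq_mul, Finset.card_univ]
        ring

end Ergodicity

/-! ### The weighted norm -/

section WeightedNorm

variable {S : Type*} [Fintype S]

/-- The quadratic form of the matrix `W`. -/
def quadForm (W : Matrix S S ℝ) (v : S → ℝ) : ℝ := dotProduct v (W.mulVec v)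

variable [DecidableEq S]

theorem hasEigenvalue_of_mulVec_eq {W : Matrix S S ℝ} {l : ℝ} {v : S → ℝ} (hv : v ≠ 0)
    (h : W.mulVec v = l • v) : Module.End.HasEigenvalue (Matrix.toLin' W) l :=
  Module.End.hasEigenvalue_of_hasEigenvector (x := v)
    ⟨Module.End.mem_eigenspace_iff.2 (by rw [Matrix.toLin'_apply, h]), hv⟩

theorem eigenvectorBasis_ne_zero {W : Matrix S S ℝ} (hH : W.IsHermitian) (i : S) :
    (hH.eigenvectorBasis i : S → ℝ) ≠ 0 := fun h => by
  have h1 := hH.eigenvectorBasis.orthonormal.ne_zero i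
  exact h1 (by ext s; exact congrFun h s)

/-- The largest eigenvalue of a symmetric matrix exists and bounds its quadratic form. -/
theorem exists_isMaxEigenvalue [Nonempty S] {W : Matrix S S ℝ} (hW : W.transpose = W) :
    ∃ l, IsMaxEigenvalue W l ∧ ∀ v, quadForm W v ≤ l * dotProduct v v := by
  have hH : W.IsHermitian := by
    rw [Matrix.IsHermitian, Matrix.conjTranspose_eq_transpose_of_trivial, hW]
  have hne : {x : ℝ | Module.End.HasEigenvalue (Matrix.toLin' W) x}.Nonempty :=
    ⟨hH.eigenvalues (Classical.arbitrary S),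
      hasEigenvalue_of_mulVec_eq (eigenvectorBasis_ne_zero hH _) (hH.mulVec_eigenvectorBasis _)⟩
  have hfin : {x : ℝ | Module.End.HasEigenvalue (Matrix.toLin' W) x}.Finite :=
    Module.End.finite_hasEigenvalue _
  obtain ⟨l, hl, hmax⟩ := Set.exists_max_image _ id hfin hne
  refine ⟨l, ⟨hl, hmax⟩, fun v => ?_⟩
  have hH2 : (l • (1 : Matrix S S ℝ) - W).IsHermitian := by
    rw [Matrix.IsHermitian, Matrix.conjTranspose_eq_transpose_of_trivial,
      Matrix.transpose_sub, hW, Matrix.transpose_smul, Matrix.transpose_one]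
  have hpsd : (l • (1 : Matrix S S ℝ) - W).PosSemidef := by
    -- An eigenvector of `l • 1 - W` with eigenvalue `θ` is one of `W` with eigenvalue `l - θ`;
    -- maximality of `l` gives `θ ≥ 0`.
    refine hH2.posSemidef_iff_eigenvalues_nonneg.2 fun i => ?_
    have h1 := hH2.mulVec_eigenvectorBasis i
    rw [Matrix.sub_mulVec, Matrix.smul_mulVec, Matrix.one_mulVec] at h1
    have h2 := hmax (l - hH2.eigenvalues i)
      (hasEigenvalue_of_mulVec_eq (eigenvectorBasis_ne_zero hH2 i) (by
        rw [sub_smul, ← h1, sub_sub_cancel]))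
    simpa using h2
  have h := hpsd.re_dotProduct_nonneg v
  simp only [star_trivial, Matrix.sub_mulVec, Matrix.smul_mulVec, Matrix.one_mulVec,
    dotProduct_sub, dotProduct_smul, smul_eq_mul, RCLike.re_to_real] at h
  rw [quadForm]
  linarith

/-- A symmetric positive semidefinite form gives a subadditive function. -/
theorem sqrt_quadForm_add_le {W : Matrix S S ℝ} (hW : W.transpose = W)
    (hpos : ∀ v, 0 ≤ quadForm W v) (v w : S → ℝ) :
    Real.sqrt (quadForm W (v + w)) ≤ Real.sqrt (quadForm W v) + Real.sqrt (quadForm W w) := by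
  have happ : ∀ x y, Matrix.toBilin' W x y = dotProduct x (W.mulVec y) := fun x y =>
    Matrix.toBilin'_apply' W x y
  have hsymm : dotProduct w (W.mulVec v) = dotProduct v (W.mulVec w) := by
    rw [Matrix.dotProduct_mulVec, ← Matrix.mulVec_transpose, hW, dotProduct_comm]
  have hcs := LinearMap.BilinForm.apply_mul_apply_le_of_forall_zero_le (Matrix.toBilin' W)
    (fun x => by rw [happ]; exact hpos x) v w
  rw [happ, happ, happ, happ, hsymm] at hcs
  have hexp : quadForm W (v + w)
      = quadForm W v + 2 * dotProduct v (W.mulVec w) + quadForm W w := by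
    simp only [quadForm, Matrix.mulVec_add, dotProduct_add, add_dotProduct, hsymm]
    ring
  have hle : dotProduct v (W.mulVec w) ≤ Real.sqrt (quadForm W v) * Real.sqrt (quadForm W w) := by
    rw [← Real.sqrt_mul (hpos v)]
    exact Real.le_sqrt_of_sq_le (by rw [sq]; exact hcs)
  refine Real.sqrt_le_iff.2 ⟨by positivity, ?_⟩
  rw [hexp, add_sq, Real.sq_sqrt (hpos v), Real.sq_sqrt (hpos w)]
  linarith

section

variable {Q : Matrix S S ℝ} {μ : S → ℝ}

theorem weightTerm_eq (Q : Matrix S S ℝ) (μ : S → ℝ) (k : ℕ) :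
    weightTerm Q μ k = (Q - Matrix.of fun (_ : S) s' => μ s') ^ k *
      ((Q - Matrix.of fun (_ : S) s' => μ s') ^ k).transpose := by
  rw [weightTerm, ← Matrix.transpose_sub, Matrix.transpose_pow]

theorem weightTerm_succ (Q : Matrix S S ℝ) (μ : S → ℝ) (k : ℕ) :
    weightTerm Q μ (k + 1) = (Q - Matrix.of fun (_ : S) s' => μ s') * weightTerm Q μ k *
      (Q - Matrix.of fun (_ : S) s' => μ s').transpose := by
  rw [weightTerm_eq, weightTerm_eq, pow_succ', Matrix.transpose_mul]
  simp only [mul_assoc]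

theorem weightMatrix_transpose (Q : Matrix S S ℝ) (μ : S → ℝ) :
    (weightMatrix Q μ).transpose = weightMatrix Q μ := by
  rw [weightMatrix, Matrix.transpose_tsum]
  refine tsum_congr fun k => ?_
  rw [weightTerm_eq, Matrix.transpose_mul, Matrix.transpose_transpose]

/-- With `A = Q - Ξ` this is the discrete Lyapunov equation `W = 1 + A W Aᵀ`, obtained by splitting
off the term `k = 0`. It makes the quadratic form lose exactly `|v|²` when `v` is replaced by `vA`.
-/
theorem weightMatrix_eq (hs : Summable (weightTerm Q μ)) :
    weightMatrix Q μ = 1 + (Q - Matrix.of fun (_ : S) s' => μ s') * weightMatrix Q μ *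
      (Q - Matrix.of fun (_ : S) s' => μ s').transpose := by
  have h1 : (∑' k, weightTerm Q μ (k + 1)) = (Q - Matrix.of fun (_ : S) s' => μ s') *
      weightMatrix Q μ * (Q - Matrix.of fun (_ : S) s' => μ s').transpose := by
    simp only [weightTerm_succ]
    rw [(hs.mul_left _).tsum_mul_right, hs.tsum_mul_left, weightMatrix]
  rw [← h1, weightMatrix, hs.tsum_eq_zero_add]
  congr 1
  simp [weightTerm_eq]

theorem quadForm_weightMatrix_nonneg (hs : Summable (weightTerm Q μ)) (v : S → ℝ) :
    0 ≤ quadForm (weightMatrix Q μ) v := by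
  have hcont : Continuous fun W : Matrix S S ℝ => quadForm W v := by
    unfold quadForm
    fun_prop
  have h := hs.hasSum.map (⟨⟨fun W => quadForm W v, by simp [quadForm]⟩,
    fun A B => by simp [quadForm, Matrix.add_mulVec, dotProduct_add]⟩ : Matrix S S ℝ →+ ℝ) hcont
  refine h.nonneg fun k => ?_
  change 0 ≤ quadForm (weightTerm Q μ k) v
  rw [quadForm, weightTerm_eq, ← Matrix.mulVec_mulVec, Matrix.dotProduct_mulVec,
    Matrix.mulVec_transpose]
  exact Finset.sum_nonneg fun _ _ => mul_self_nonneg _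

theorem quadForm_weightMatrix_eq (hs : Summable (weightTerm Q μ)) (v : S → ℝ) :
    quadForm (weightMatrix Q μ) v = dotProduct v v + quadForm (weightMatrix Q μ)
      (Matrix.vecMul v (Q - Matrix.of fun (_ : S) s' => μ s')) := by
  conv_lhs => rw [weightMatrix_eq hs, quadForm, Matrix.add_mulVec, Matrix.one_mulVec,
    dotProduct_add, mul_assoc, ← Matrix.mulVec_mulVec, Matrix.dotProduct_mulVec,
    ← Matrix.mulVec_mulVec, Matrix.mulVec_transpose]
  rfl

/-- A weighted norm: a subadditive function that dominates the entries, is dominated by the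
`ℓ¹` norm, and is contracted by the chain on the vectors of total mass zero. -/
structure IsWeightedNorm (Q : Matrix S S ℝ) (lam : ℝ) (h : (S → ℝ) → ℝ) : Prop where
  one_le : 1 ≤ lam
  add_le : ∀ v w, h (v + w) ≤ h v + h w
  abs_le : ∀ v s, |v s| ≤ h v
  le_sum : ∀ v, h v ≤ Real.sqrt lam * ∑ s, |v s|
  contract : ∀ v, ∑ s, v s = 0 → h (Matrix.vecMul v Q) ≤ (1 - 1 / (2 * lam)) * h v

/-- The norm is `h(v) = √(v W vᵀ)`; everything follows from `|v|² ≤ h(v)² ≤ λ |v|²` and the Lyapunov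
equation. -/
theorem exists_weightedNorm [Nonempty S] (hs : Summable (weightTerm Q μ)) :
    ∃ lam : ℝ, IsMaxEigenvalue (weightMatrix Q μ) lam ∧
      ∃ h : (S → ℝ) → ℝ, IsWeightedNorm Q lam h := by
  obtain ⟨lam, hmax, hlam⟩ := exists_isMaxEigenvalue (weightMatrix_transpose Q μ)
  have hpos := quadForm_weightMatrix_nonneg hs
  have hge : ∀ v, dotProduct v v ≤ quadForm (weightMatrix Q μ) v := fun v => by
    rw [quadForm_weightMatrix_eq hs v]
    exact le_add_of_nonneg_right (hpos _)
  have hdot : ∀ v : S → ℝ, dotProduct v v = ∑ s, v s ^ 2 := fun v => by simp [dotProduct, sq]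
  -- The two bounds on the quadratic form are compared at the all-ones vector.
  have h1 : 1 ≤ lam := by
    have h2 := (hge fun _ => 1).trans (hlam fun _ => 1)
    have h3 : 0 < dotProduct (fun _ : S => (1 : ℝ)) fun _ => 1 := by
      simp [dotProduct, Fintype.card_pos]
    nlinarith
  refine ⟨lam, hmax, fun v => Real.sqrt (quadForm (weightMatrix Q μ) v), h1,
    sqrt_quadForm_add_le (weightMatrix_transpose Q μ) hpos, fun v s => ?_, fun v => ?_,
    fun v hv => ?_⟩
  · refine Real.abs_le_sqrt (le_trans ?_ (hge v))
    rw [hdot]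
    exact Finset.single_le_sum (f := fun s => v s ^ 2) (fun _ _ => sq_nonneg _) (Finset.mem_univ s)
  · rw [← Real.sqrt_sq (Finset.sum_nonneg fun s _ => abs_nonneg (v s)),
      ← Real.sqrt_mul (zero_le_one.trans h1)]
    refine Real.sqrt_le_sqrt ((hlam v).trans (mul_le_mul_of_nonneg_left ?_ (zero_le_one.trans h1)))
    rw [hdot]
    simp only [← sq_abs (v _)]
    exact Finset.sum_sq_le_sq_sum_of_nonneg fun _ _ => abs_nonneg _
  -- `h(vQ)² = h(v)² - |v|² ≤ (1 - 1/λ) h(v)² ≤ (1 - 1/(2λ))² h(v)²`.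
  · have h2 := quadForm_weightMatrix_eq hs v
    rw [vecMul_sub_stationary μ hv] at h2
    have h3 : quadForm (weightMatrix Q μ) v / lam ≤ dotProduct v v := by
      rw [div_le_iff₀ (by linarith), mul_comm]
      exact hlam v
    have h5 : 1 / (2 * lam) ≤ 1 := by
      rw [div_le_one (by linarith)]
      linarith
    have h6 : 0 ≤ 1 - 1 / (2 * lam) := by linarith
    rw [← Real.sqrt_sq h6, ← Real.sqrt_mul (sq_nonneg _)]
    refine Real.sqrt_le_sqrt ?_
    have h4 : (1 - 1 / (2 * lam)) ^ 2 = 1 - 1 / lam + (1 / (2 * lam)) ^ 2 := by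
      field_simp
      ring
    rw [h4]
    have h7 := mul_nonneg (sq_nonneg (1 / (2 * lam))) (hpos v)
    have h8 : quadForm (weightMatrix Q μ) v / lam = 1 / lam * quadForm (weightMatrix Q μ) v := by
      ring
    linarith

end

end WeightedNorm

/-! ### The linear program bounds the reward of every policy -/

section LinearProgramBound

variable {S : Type*} [Fintype S] {N : ℕ}

theorem abs_reward_le (M : SingleArmedMDP S) (s : S) (a : Bool) : |M.r s a| ≤ M.rmax :=
  le_ciSup (f := fun p : S × Bool => |M.r p.1 p.2|) (Set.finite_range _).bddAbove (s, a)

theorem mean_indicator_eq {β : Type*} [Fintype β] [DecidableEq β] (p : PMF β) (s : β) :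
    mean p (fun x => if x = s then 1 else 0) = (p s).toReal := by
  simp [mean]

theorem stateActionLaw_succ_map_fst (M : SingleArmedMDP S) (π : Policy S N) (s₀ : Fin N → S)
    (t : ℕ) :
    (stateActionLaw M π s₀ (t + 1)).map Prod.fst
      = (stateActionLaw M π s₀ t).bind fun x => indepLaw fun i => M.P (x.1 i) (x.2 i) := by
  have hconst : ∀ (p : PMF (π.Mem × (Fin N → Bool))) (x : Fin N → S),
      p.map (fun _ => x) = PMF.pure x := fun p x => PMF.map_const p x
  simp only [stateActionLaw, stateLaw, PMF.map_bind, PMF.bind_bind, PMF.bind_map, PMF.map_comp,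
    Function.comp_def, hconst, PMF.bind_pure]

theorem expectedReward_eq_mean (M : SingleArmedMDP S) (π : Policy S N) (s₀ : Fin N → S) (t : ℕ) :
    expectedReward M π s₀ t = mean (stateActionLaw M π s₀ t)
      fun x => (1 / (N : ℝ)) * ∑ i, M.r (x.1 i) (x.2 i) := by
  rw [mean, Fintype.sum_prod_type, expectedReward]

/-- Serves for averages over arms and over time alike. An empty average is `0`, so no positivity of
`N` is needed and the reward bound also covers horizon `0`. -/
theorem abs_average_le {N : ℕ} {f : Fin N → ℝ} {c : ℝ} (hc : 0 ≤ c) (h : ∀ i, |f i| ≤ c) :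
    |(1 / (N : ℝ)) * ∑ i, f i| ≤ c := by
  rcases Nat.eq_zero_or_pos N with rfl | hN
  · simpa using hc
  have hN' : (0 : ℝ) < N := Nat.cast_pos.2 hN
  rw [abs_mul, abs_of_pos (by positivity), one_div, inv_mul_le_iff₀ hN']
  refine (Finset.abs_sum_le_sum_abs _ _).trans ((Finset.sum_le_sum fun i _ => h i).trans_eq ?_)
  simp

omit [Fintype S] in
theorem rmax_nonneg (M : SingleArmedMDP S) : 0 ≤ M.rmax := Real.iSup_nonneg fun _ => abs_nonneg _

theorem abs_expectedReward_le (M : SingleArmedMDP S) (π : Policy S N) (s₀ : Fin N → S) (t : ℕ) :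
    |expectedReward M π s₀ t| ≤ M.rmax := by
  rw [expectedReward_eq_mean]
  exact (abs_mean_le _ _).trans (mean_le_of_forall fun x _ =>
    abs_average_le (rmax_nonneg M) fun i => abs_reward_le M _ _)

theorem abs_averageReward_le (M : SingleArmedMDP S) (π : Policy S N) (s₀ : Fin N → S) (T : ℕ) :
    |averageReward M π s₀ T| ≤ M.rmax := by
  rw [averageReward, ← Fin.sum_univ_eq_sum_range]
  exact abs_average_le (rmax_nonneg M) fun t => abs_expectedReward_le M π s₀ t

variable [DecidableEq S]

/-- The expected fraction of arms with state `s` and action `a` at time `t`. -/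
noncomputable def occupation (M : SingleArmedMDP S) (π : Policy S N) (s₀ : Fin N → S) (t : ℕ) (s : S)
    (a : Bool) : ℝ :=
  mean (stateActionLaw M π s₀ t)
    fun x => (1 / (N : ℝ)) * ∑ i, if x.1 i = s ∧ x.2 i = a then 1 else 0

/-- Choosing the weights `c` yields the total mass, the budget, the flow balance and the reward as
linear functionals of the occupation measure. -/
theorem sum_mul_occupation (M : SingleArmedMDP S) (π : Policy S N) (s₀ : Fin N → S) (t : ℕ)
    (c : S → Bool → ℝ) :
    ∑ s, ∑ a, c s a * occupation M π s₀ t s a = mean (stateActionLaw M π s₀ t)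
      fun x => (1 / (N : ℝ)) * ∑ i, c (x.1 i) (x.2 i) := by
  have h : ∀ x : (Fin N → S) × (Fin N → Bool), (1 / (N : ℝ)) * ∑ i, c (x.1 i) (x.2 i)
      = ∑ s, ∑ a, c s a * ((1 / (N : ℝ)) * ∑ i, if x.1 i = s ∧ x.2 i = a then 1 else 0) :=
    fun x => by
    have h1 : ∀ i, c (x.1 i) (x.2 i)
        = ∑ s, ∑ a, c s a * (if x.1 i = s ∧ x.2 i = a then 1 else 0) := fun i => by
      simp only [ite_and, mul_ite, mul_one, mul_zero]
      rw [Finset.sum_eq_single (x.1 i)]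
      · simp only [if_true, Finset.sum_ite_eq, Finset.mem_univ]
      · intro s _ hs
        simp [hs.symm]
      · simp
    simp only [h1, Finset.mul_sum]
    rw [Finset.sum_comm]
    refine Finset.sum_congr rfl fun s _ => ?_
    rw [Finset.sum_comm]
    exact Finset.sum_congr rfl fun a _ => Finset.sum_congr rfl fun i _ => by ring
  simp only [h, occupation]
  rw [mean_sum]
  refine Finset.sum_congr rfl fun s _ => ?_
  rw [mean_sum]
  exact Finset.sum_congr rfl fun a _ => (mean_const_mul _ _ _).symm

theorem occupation_nonneg (M : SingleArmedMDP S) (π : Policy S N) (s₀ : Fin N → S) (t : ℕ) (s : S)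
    (a : Bool) : 0 ≤ occupation M π s₀ t s a :=
  le_mean_of_forall fun x _ => mul_nonneg (by positivity)
    (Finset.sum_nonneg fun i _ => by split_ifs <;> norm_num)

theorem sum_occupation (hN : 0 < N) (M : SingleArmedMDP S) (π : Policy S N) (s₀ : Fin N → S)
    (t : ℕ) : ∑ s, ∑ a, occupation M π s₀ t s a = 1 := by
  have h := sum_mul_occupation M π s₀ t fun _ _ => 1
  simp only [one_mul] at h
  rw [h, mean_const]
  have : (N : ℝ) ≠ 0 := Nat.cast_ne_zero.2 hN.ne'
  simp [this]

theorem sum_occupation_true {B : ℕ} (M : SingleArmedMDP S) {π : Policy S N} {s₀ : Fin N → S}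
    (hπ : SatisfiesBudget M π s₀ B) (t : ℕ) :
    ∑ s, occupation M π s₀ t s true = (1 / (N : ℝ)) * B := by
  have h := sum_mul_occupation M π s₀ t fun _ a => if a = true then 1 else 0
  simp only [Fintype.sum_bool, if_true, Bool.false_eq_true, if_false, one_mul, zero_mul,
    add_zero] at h
  rw [h, ← mean_const (stateActionLaw M π s₀ t) ((1 / (N : ℝ)) * B)]
  refine mean_congr fun x hx => ?_
  rw [← hπ t x hx, pulls, Finset.card_filter]
  push_cast
  rfl

theorem sum_occupation_succ (M : SingleArmedMDP S) (π : Policy S N) (s₀ : Fin N → S) (t : ℕ)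
    (s : S) : ∑ a, occupation M π s₀ (t + 1) s a
      = ∑ s', ∑ a, occupation M π s₀ t s' a * (M.P s' a s).toReal := by
  have h1 := sum_mul_occupation M π s₀ (t + 1) fun s' _ => if s' = s then 1 else 0
  have h2 := sum_mul_occupation M π s₀ t fun s' a => (M.P s' a s).toReal
  have h3 := congrArg (fun p => mean p fun x => (1 / (N : ℝ)) * ∑ i, if x i = s then 1 else 0)
    (stateActionLaw_succ_map_fst M π s₀ t)
  simp only [mean_map, mean_bind] at h3
  simp only [mul_comm (occupation _ _ _ _ _ _)]
  rw [h2]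
  have h4 : ∀ s', ∑ a, (if s' = s then (1 : ℝ) else 0) * occupation M π s₀ (t + 1) s' a
      = if s' = s then ∑ a, occupation M π s₀ (t + 1) s' a else 0 := fun s' => by
    split_ifs <;> simp
  simp only [h4, Finset.sum_ite_eq', Finset.mem_univ, if_true] at h1
  rw [h1, h3]
  refine mean_congr fun x _ => ?_
  rw [mean_const_mul, mean_sum]
  congr 1
  refine Finset.sum_congr rfl fun i _ => ?_
  rw [mean_indepLaw_apply (fun i => M.P (x.1 i) (x.2 i)) i fun s' => if s' = s then (1 : ℝ) else 0,
    mean_indicator_eq]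

/-- The time average of the occupation measures before time `T`. -/
noncomputable def averageOccupation (M : SingleArmedMDP S) (π : Policy S N) (s₀ : Fin N → S) (T : ℕ) (s : S)
    (a : Bool) : ℝ :=
  (1 / (T : ℝ)) * ∑ t ∈ Finset.range T, occupation M π s₀ t s a

theorem averageReward_eq (M : SingleArmedMDP S) (π : Policy S N) (s₀ : Fin N → S) (T : ℕ) :
    averageReward M π s₀ T = ∑ s, ∑ a, M.r s a * averageOccupation M π s₀ T s a := by
  have h : ∀ t, expectedReward M π s₀ t = ∑ s, ∑ a, M.r s a * occupation M π s₀ t s a := fun t =>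
    by rw [expectedReward_eq_mean, sum_mul_occupation M π s₀ t M.r]
  simp only [averageReward, averageOccupation, h, Finset.mul_sum]
  rw [Finset.sum_comm]
  refine Finset.sum_congr rfl fun s _ => ?_
  rw [Finset.sum_comm]
  exact Finset.sum_congr rfl fun a _ => Finset.sum_congr rfl fun t _ => by ring

theorem averageOccupation_nonneg (M : SingleArmedMDP S) (π : Policy S N) (s₀ : Fin N → S) (T : ℕ)
    (s : S) (a : Bool) : 0 ≤ averageOccupation M π s₀ T s a :=
  mul_nonneg (by positivity) (Finset.sum_nonneg fun _ _ => occupation_nonneg _ _ _ _ _ _)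

theorem sum_averageOccupation (hN : 0 < N) (M : SingleArmedMDP S) (π : Policy S N)
    (s₀ : Fin N → S) {T : ℕ} (hT : 0 < T) :
    ∑ s, ∑ a, averageOccupation M π s₀ T s a = 1 := by
  have hT' : (T : ℝ) ≠ 0 := Nat.cast_ne_zero.2 hT.ne'
  simp only [averageOccupation, ← Finset.mul_sum]
  simp only [Finset.sum_comm (t := Finset.range T), sum_occupation hN]
  simp [hT']

theorem sum_averageOccupation_true {B : ℕ} (M : SingleArmedMDP S) {π : Policy S N}
    {s₀ : Fin N → S} (hπ : SatisfiesBudget M π s₀ B) {T : ℕ} (hT : 0 < T) :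
    ∑ s, averageOccupation M π s₀ T s true = (1 / (N : ℝ)) * B := by
  have hT' : (T : ℝ) ≠ 0 := Nat.cast_ne_zero.2 hT.ne'
  simp only [averageOccupation, ← Finset.mul_sum]
  simp only [Finset.sum_comm (t := Finset.range T), sum_occupation_true M hπ]
  rw [Finset.sum_const, Finset.card_range, nsmul_eq_mul, ← mul_assoc, one_div, inv_mul_cancel₀ hT',
    one_mul]

/-- The flow out of time `t` is the state marginal at time `t + 1`, so the averaged imbalance
telescopes to two marginals in `[0, 1]` divided by `T`. -/
theorem abs_averageOccupation_flow_le (hN : 0 < N) (M : SingleArmedMDP S) (π : Policy S N)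
    (s₀ : Fin N → S) (T : ℕ) (s : S) :
    |∑ s', ∑ a, averageOccupation M π s₀ T s' a * (M.P s' a s).toReal
      - ∑ a, averageOccupation M π s₀ T s a| ≤ 1 / (T : ℝ) := by
  have hle : ∀ t, ∑ a, occupation M π s₀ t s a ≤ 1 := fun t => by
    rw [← sum_occupation hN M π s₀ t]
    exact Finset.single_le_sum (f := fun s => ∑ a, occupation M π s₀ t s a)
      (fun _ _ => Finset.sum_nonneg fun _ _ => occupation_nonneg _ _ _ _ _ _) (Finset.mem_univ s)
  have h0 : ∀ t, 0 ≤ ∑ a, occupation M π s₀ t s a := fun t =>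
    Finset.sum_nonneg fun _ _ => occupation_nonneg _ _ _ _ _ _
  have h1 : ∑ s', ∑ a, averageOccupation M π s₀ T s' a * (M.P s' a s).toReal
      = (1 / (T : ℝ)) * ∑ t ∈ Finset.range T, ∑ a, occupation M π s₀ (t + 1) s a := by
    simp only [sum_occupation_succ, averageOccupation, mul_assoc, Finset.sum_mul, ← Finset.mul_sum]
    congr 1
    rw [Finset.sum_comm' (t' := Finset.univ) (s' := fun _ => Finset.range T) (by simp)]
    refine Finset.sum_congr rfl fun s' _ => ?_
    rw [Finset.sum_comm]
  have h2 : ∑ a, averageOccupation M π s₀ T s a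
      = (1 / (T : ℝ)) * ∑ t ∈ Finset.range T, ∑ a, occupation M π s₀ t s a := by
    simp only [averageOccupation, ← Finset.mul_sum]
    rw [Finset.sum_comm]
  rw [h1, h2, ← mul_sub, ← Finset.sum_sub_distrib,
    Finset.sum_range_sub fun t => ∑ a, occupation M π s₀ t s a, abs_mul,
    abs_of_nonneg (by positivity : (0 : ℝ) ≤ 1 / T)]
  refine mul_le_of_le_one_right (by positivity) (abs_le.2 ⟨?_, ?_⟩) <;>
    linarith [h0 0, h0 T, hle 0, hle T]

/-- The linear program bounds the liminf average reward of every policy within the budget. -/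
theorem liminfReward_le_lpObjective {B : ℕ} {α : ℝ} (hN : 0 < N) (hB : (B : ℝ) = α * N)
    {M : SingleArmedMDP S} {y : S → Bool → ℝ≥0} (hy : LPOptimal M α y) {π : Policy S N}
    {s₀ : Fin N → S} (hπ : SatisfiesBudget M π s₀ B) :
    liminfReward M π s₀ ≤ lpObjective M y := by
  have hN' : (N : ℝ) ≠ 0 := Nat.cast_ne_zero.2 hN.ne'
  have hmem : ∀ T, averageOccupation M π s₀ (T + 1)
      ∈ Set.Icc (0 : S → Bool → ℝ) (fun _ _ => 1) := fun T => by
    refine ⟨fun s a => averageOccupation_nonneg M π s₀ _ s a, fun s a => ?_⟩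
    rw [← sum_averageOccupation hN M π s₀ T.succ_pos]
    refine le_trans ?_ (Finset.single_le_sum
      (f := fun s => ∑ a, averageOccupation M π s₀ (T + 1) s a)
      (fun _ _ => Finset.sum_nonneg fun _ _ => averageOccupation_nonneg _ _ _ _ _ _)
      (Finset.mem_univ s))
    exact Finset.single_le_sum (f := fun a => averageOccupation M π s₀ (T + 1) s a)
      (fun _ _ => averageOccupation_nonneg _ _ _ _ _ _) (Finset.mem_univ a)
  -- A limit point `z` of the averages satisfies the constraints of the linear program, and its
  -- objective is a subsequential limit of the average rewards. The shift to `T + 1` skips the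
  -- horizon `0`, where the average vanishes.
  obtain ⟨z, hz, φ, hφ, hlim⟩ := isCompact_Icc.tendsto_subseq hmem
  have hlim' : ∀ s a, Tendsto (fun n => averageOccupation M π s₀ (φ n + 1) s a) atTop
      (𝓝 (z s a)) := fun s a => tendsto_pi_nhds.1 (tendsto_pi_nhds.1 hlim s) a
  have hφ1 : Tendsto (fun n => φ n + 1) atTop atTop :=
    tendsto_atTop_mono (fun n => Nat.le_succ (φ n)) hφ.tendsto_atTop
  set w : S → Bool → ℝ≥0 := fun s a => ⟨z s a, hz.1 s a⟩ with hw
  have hwz : ∀ s a, (w s a : ℝ) = z s a := fun s a => rfl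
  have hfeas : LPFeasible M α w := by
    refine ⟨?_, fun s => ?_, ?_⟩
    · simp only [hwz]
      refine tendsto_nhds_unique (tendsto_finsetSum _ fun s _ => hlim' s true) ?_
      simp only [sum_averageOccupation_true M hπ (Nat.succ_pos _), hB]
      rw [show 1 / (N : ℝ) * (α * N) = α by field_simp]
      exact tendsto_const_nhds
    · simp only [hwz]
      have h1 := (tendsto_finsetSum Finset.univ fun s' _ => tendsto_finsetSum Finset.univ
        fun a _ => (hlim' s' a).mul_const (M.P s' a s).toReal).sub
        (tendsto_finsetSum Finset.univ fun a _ => hlim' s a)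
      have h2 : Tendsto (fun n => ∑ s', ∑ a, averageOccupation M π s₀ (φ n + 1) s' a *
          (M.P s' a s).toReal - ∑ a, averageOccupation M π s₀ (φ n + 1) s a) atTop (𝓝 0) :=
        squeeze_zero_norm (fun n => (Real.norm_eq_abs _).trans_le
          (abs_averageOccupation_flow_le hN M π s₀ (φ n + 1) s))
          ((tendsto_one_div_atTop_nhds_zero_nat (𝕜 := ℝ)).comp hφ1)
      exact sub_eq_zero.1 (tendsto_nhds_unique h1 h2)
    · simp only [hwz]
      refine tendsto_nhds_unique (tendsto_finsetSum _ fun s _ => tendsto_finsetSum _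
        fun a _ => hlim' s a) ?_
      simp only [sum_averageOccupation hN M π s₀ (Nat.succ_pos _)]
      exact tendsto_const_nhds
  have hobj : Tendsto (fun n => averageReward M π s₀ (φ n + 1)) atTop (𝓝 (lpObjective M w)) := by
    simp only [averageReward_eq, lpObjective, hwz]
    exact tendsto_finsetSum _ fun s _ => tendsto_finsetSum _ fun a _ => (hlim' s a).const_mul _
  refine le_of_forall_lt fun c hc => ?_
  obtain ⟨c', hcc', hc'⟩ := exists_between hc
  have hev : ∀ᶠ T in atTop, c' < averageReward M π s₀ T :=
    eventually_lt_of_lt_liminf hc' (isBoundedUnder_of ⟨-M.rmax, fun T =>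
      (abs_le.1 (abs_averageReward_le M π s₀ T)).1⟩)
  have hle := ge_of_tendsto hobj ((hφ1.eventually hev).mono fun n hn => hn.le)
  exact hcc'.trans_le (hle.trans (hy.2 w hfeas))

end LinearProgramBound

/-! ### The focus sets -/

section FocusSets

variable {N : ℕ}

theorem frac_nonneg (D : Finset (Fin N)) : 0 ≤ frac D := by
  unfold frac
  positivity

theorem frac_le_one (D : Finset (Fin N)) : frac D ≤ 1 := by
  unfold frac
  refine div_le_one_of_le₀ ?_ (Nat.cast_nonneg N)
  exact_mod_cast (Finset.card_le_univ D).trans_eq (Fintype.card_fin N)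

theorem frac_mono {D E : Finset (Fin N)} (h : D.card ≤ E.card) : frac D ≤ frac E := by
  unfold frac
  gcongr

theorem frac_union {D F : Finset (Fin N)} (h : Disjoint D F) : frac (D ∪ F) = frac D + frac F := by
  rw [frac, Finset.card_union_of_disjoint h, Nat.cast_add, add_div, frac, frac]

variable {S : Type*} [Fintype S] [DecidableEq S]

/-- The deviation of the scaled state-count vector on `D` from its stationary value. -/
noncomputable def deviation (μ : S → ℝ) (s : Fin N → S) (D : Finset (Fin N)) (x : S) : ℝ :=
  scaledCount s D x - frac D * μ x

omit [Fintype S] in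
theorem scaledCount_nonneg (s : Fin N → S) (D : Finset (Fin N)) (x : S) :
    0 ≤ scaledCount s D x := by
  unfold scaledCount
  positivity

theorem sum_scaledCount (s : Fin N → S) (D : Finset (Fin N)) : ∑ x, scaledCount s D x = frac D := by
  simp only [scaledCount, ← Finset.mul_sum]
  rw [← Nat.cast_sum, ← Finset.card_eq_sum_card_fiberwise (fun _ _ => Finset.mem_univ _), frac]
  ring

omit [Fintype S] in
theorem scaledCount_union (s : Fin N → S) {D F : Finset (Fin N)} (h : Disjoint D F) (x : S) :
    scaledCount s (D ∪ F) x = scaledCount s D x + scaledCount s F x := by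
  rw [scaledCount, Finset.filter_union, Finset.card_union_of_disjoint
    (Finset.disjoint_filter_filter h), Nat.cast_add, mul_add, scaledCount, scaledCount]

omit [Fintype S] in
theorem deviation_union (μ : S → ℝ) (s : Fin N → S) {D F : Finset (Fin N)} (h : Disjoint D F) :
    deviation μ s (D ∪ F) = deviation μ s D + deviation μ s F := by
  funext x
  simp only [deviation, Pi.add_apply, scaledCount_union s h, frac_union h]
  ring

variable {μ : S → ℝ}

theorem sum_deviation (hμ1 : ∑ x, μ x = 1) (s : Fin N → S) (D : Finset (Fin N)) :
    ∑ x, deviation μ s D x = 0 := by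
  simp only [deviation, Finset.sum_sub_distrib, sum_scaledCount, ← Finset.mul_sum, hμ1]
  ring

theorem sum_abs_deviation_le (hμ0 : ∀ x, 0 ≤ μ x) (hμ1 : ∑ x, μ x = 1) (s : Fin N → S)
    (D : Finset (Fin N)) : ∑ x, |deviation μ s D x| ≤ 2 * frac D := by
  calc ∑ x, |deviation μ s D x| ≤ ∑ x, (scaledCount s D x + frac D * μ x) := by
        refine Finset.sum_le_sum fun x _ => ?_
        have h1 := scaledCount_nonneg s D x
        have h2 := mul_nonneg (frac_nonneg D) (hμ0 x)
        rw [deviation, abs_le]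
        constructor <;> linarith
    _ = 2 * frac D := by
        rw [Finset.sum_add_distrib, sum_scaledCount, ← Finset.mul_sum, hμ1]
        ring

theorem slack_eq (α : ℝ) (μ : S → ℝ) (s : Fin N → S) (D : Finset (Fin N)) :
    slack α μ s D = min α (1 - α) * (1 - frac D) - 1 / 2 * ∑ x, |deviation μ s D x| := rfl

/-- Adding `F` costs `β m(F)` in the first term and at most half of `2 m(F)` in the `ℓ¹` term. -/
theorem slack_union_ge {α : ℝ} (hμ0 : ∀ x, 0 ≤ μ x) (hμ1 : ∑ x, μ x = 1) (s : Fin N → S)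
    {D F : Finset (Fin N)} (h : Disjoint D F) :
    slack α μ s D - (min α (1 - α) + 1) * frac F ≤ slack α μ s (D ∪ F) := by
  have h1 := sum_abs_deviation_le hμ0 hμ1 s F
  have h2 : ∑ x, |deviation μ s (D ∪ F) x|
      ≤ ∑ x, |deviation μ s D x| + ∑ x, |deviation μ s F x| := by
    rw [← Finset.sum_add_distrib, deviation_union μ s h]
    exact Finset.sum_le_sum fun x _ => abs_add_le _ _
  rw [slack_eq, slack_eq, frac_union h]
  linarith

theorem IsFocusUpdate.slack_nonneg {α : ℝ} {s : Fin N → S} {D' D : Finset (Fin N)}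
    (h : IsFocusUpdate α μ s D' D) : 0 ≤ slack α μ s D := by
  rcases lt_or_ge 0 (slack α μ s D') with h1 | h1
  · exact (h.1 h1).1.2
  · exact (h.2 h1).1.2

theorem IsFocusUpdate.subset_or_subset {α : ℝ} {s : Fin N → S} {D' D : Finset (Fin N)}
    (h : IsFocusUpdate α μ s D' D) : D' ⊆ D ∨ D ⊆ D' := by
  rcases lt_or_ge 0 (slack α μ s D') with h1 | h1
  · exact Or.inl (h.1 h1).1.1
  · exact Or.inr (h.2 h1).1.1

/-- The fraction of arms outside the focus set is controlled by the deviation on it. -/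
theorem IsFocusUpdate.coverage {α : ℝ} (hN : 0 < N) (hα1 : α < 1)
    (hμ0 : ∀ x, 0 ≤ μ x) (hμ1 : ∑ x, μ x = 1) {s : Fin N → S} {D' D : Finset (Fin N)}
    (h : IsFocusUpdate α μ s D' D) :
    min α (1 - α) * (1 - frac D) ≤ 1 / 2 * ∑ x, |deviation μ s D x| + 2 / N := by
  -- Otherwise the slack exceeds `2/N`. One more arm costs at most `(β + 1)/N ≤ 2/N`, so `D` could
  -- be enlarged, against maximality. When expanding, a spare arm exists since the full set has
  -- slack at most `0`; when shrinking, it lies in `D' \ D`, since `D = D'` would have slack at most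
  -- `0`.
  by_contra hcon
  have hN' : (0 : ℝ) < N := Nat.cast_pos.2 hN
  have hβ1 : min α (1 - α) ≤ 1 := (min_le_left _ _).trans hα1.le
  have hslack : 2 / (N : ℝ) < slack α μ s D := by
    rw [slack_eq]
    linarith
  have hslack0 : 0 < slack α μ s D := lt_trans (by positivity) hslack
  have hins : ∀ i ∉ D, 0 ≤ slack α μ s (D ∪ {i}) := fun i hi => by
    refine le_trans ?_ (slack_union_ge hμ0 hμ1 s (Finset.disjoint_singleton_right.2 hi))
    have h1 : frac ({i} : Finset (Fin N)) = 1 / N := by simp [frac]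
    have h2 : (min α (1 - α) + 1) * (1 / (N : ℝ)) ≤ 2 * (1 / N) := by
      gcongr
      linarith
    rw [h1]
    have h3 : 2 / (N : ℝ) = 2 * (1 / N) := by ring
    linarith
  have hcard : ∀ i ∉ D, ¬ (D ∪ {i}).card ≤ D.card := fun i hi => by
    rw [Finset.card_union_of_disjoint (Finset.disjoint_singleton_right.2 hi)]
    simp
  rcases lt_or_ge 0 (slack α μ s D') with h1 | h1
  · obtain ⟨i, hi⟩ : ∃ i, i ∉ D := by
      by_contra hall
      push Not at hall
      have hD : frac D = 1 := by
        rw [frac, Finset.eq_univ_iff_forall.2 hall, Finset.card_univ, Fintype.card_fin,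
          div_self hN'.ne']
      rw [slack_eq, hD] at hslack0
      have := Finset.sum_nonneg fun x (_ : x ∈ Finset.univ) => abs_nonneg (deviation μ s D x)
      linarith
    exact hcard i hi ((h.1 h1).2 _
      ⟨(h.1 h1).1.1.trans Finset.subset_union_left, hins i hi⟩)
  · obtain ⟨i, hi', hi⟩ : ∃ i ∈ D', i ∉ D := by
      by_contra hall
      push Not at hall
      rw [(h.2 h1).1.1.antisymm hall] at hslack0
      exact absurd h1 (not_le.2 hslack0)
    exact hcard i hi ((h.2 h1).2 _
      ⟨Finset.union_subset (h.2 h1).1.1 (Finset.singleton_subset_iff.2 hi'), hins i hi⟩)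

omit [Fintype S] in
/-- A subset that holds prescribed numbers of the arms in each state. -/
theorem exists_subset_filter_card [Finite S] (s : Fin N → S) (D : Finset (Fin N)) (k : S → ℕ)
    (hk : ∀ x, k x ≤ (D.filter fun i => s i = x).card) :
    ∃ E ⊆ D, ∀ x, (E.filter fun i => s i = x).card = k x := by
  have := Fintype.ofFinite S
  choose E hE hc using fun x => Finset.exists_subset_card_eq (hk x)
  refine ⟨Finset.univ.biUnion E, Finset.biUnion_subset.2 fun x _ =>
    (hE x).trans (Finset.filter_subset _ _), fun x => ?_⟩
  rw [← hc x]
  congr 1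
  ext i
  simp only [Finset.mem_filter, Finset.mem_biUnion, Finset.mem_univ, true_and]
  constructor
  · rintro ⟨⟨z, hz⟩, hx⟩
    have h1 := (Finset.mem_filter.1 (hE z hz)).2
    rw [← hx, h1]
    exact hz
  · exact fun hi => ⟨⟨x, hi⟩, (Finset.mem_filter.1 (hE x hi)).2⟩

/-- A set of arms can be thinned uniformly over the states, up to rounding. -/
theorem exists_subset_scaledCount (hN : 0 < N) (s : Fin N → S) (D : Finset (Fin N)) {γ : ℝ}
    (h0 : 0 ≤ γ) (h1 : γ ≤ 1) :
    ∃ E ⊆ D, ∀ x, γ * scaledCount s D x - 1 / N ≤ scaledCount s E x ∧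
      scaledCount s E x ≤ γ * scaledCount s D x := by
  have hN' : (0 : ℝ) < N := Nat.cast_pos.2 hN
  obtain ⟨E, hED, hE⟩ := exists_subset_filter_card s D
    (fun x => ⌊γ * ((D.filter fun i => s i = x).card : ℝ)⌋₊) fun x => by
      refine Nat.floor_le_of_le ?_
      exact mul_le_of_le_one_left (Nat.cast_nonneg _) h1
  refine ⟨E, hED, fun x => ?_⟩
  have h2 := Nat.floor_le (mul_nonneg h0 (Nat.cast_nonneg (D.filter fun i => s i = x).card))
  have h3 := Nat.lt_floor_add_one (γ * ((D.filter fun i => s i = x).card : ℝ))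
  have h4 : (0 : ℝ) ≤ 1 / N := by positivity
  rw [scaledCount, scaledCount, hE]
  constructor <;> nlinarith

/-- The focus set shrinks by little if its slack is not too negative. -/
theorem IsFocusUpdate.shrink_le {α : ℝ} (hN : 0 < N) (hα0 : 0 < α) (hα1 : α < 1)
    (hμ0 : ∀ x, 0 ≤ μ x) (hμ1 : ∑ x, μ x = 1) {s : Fin N → S} {D' D : Finset (Fin N)}
    (h : IsFocusUpdate α μ s D' D) :
    frac D' - frac D ≤
      (max (-slack α μ s D') 0 + 2 * (Fintype.card S / N)) / min α (1 - α) := by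
  have hN' : (0 : ℝ) < N := Nat.cast_pos.2 hN
  have hβ0 : 0 < min α (1 - α) := lt_min hα0 (by linarith)
  have hβ1 : min α (1 - α) ≤ 1 := (min_le_left _ _).trans hα1.le
  have hd0 : (0 : ℝ) ≤ Fintype.card S / N := by positivity
  have hm0 := frac_nonneg D
  have hm1 := frac_le_one D'
  rcases lt_or_ge 0 (slack α μ s D') with h1 | h1
  · have h2 := frac_mono (Finset.card_le_card (h.1 h1).1.1)
    have h3 : 0 ≤ (max (-slack α μ s D') 0 + 2 * (Fintype.card S / N)) / min α (1 - α) := by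
      have := le_max_right (-slack α μ s D') 0
      positivity
    linarith
  set β := min α (1 - α)
  set d : ℝ := Fintype.card S / N with hd
  rw [max_eq_left (by linarith)]
  set ε := -slack α μ s D' with hε
  have hε0 : 0 ≤ ε := by linarith
  rw [le_div_iff₀ hβ0]
  -- For `β < d` the bound is trivial, because `m(D') - m(D) ≤ 1`.
  rcases lt_or_ge β d with hβd | hβd
  · nlinarith
  -- Slack `-ε` means `β m(D') + ½‖v‖₁ = β + ε`. Thinning `D'` by `γ`, with rounding error `d`,
  -- leaves slack at least `β - d - γ (β + ε)`; this `γ` makes it zero.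
  have hγ : (β - d) / (β + ε) * (β + ε) = β - d := div_mul_cancel₀ _ (by linarith)
  set γ := (β - d) / (β + ε)
  have hγ0 : 0 ≤ γ := by
    have : 0 ≤ β - d := by linarith
    positivity
  have hγ1 : γ ≤ 1 := by
    by_contra hlt
    push Not at hlt
    nlinarith
  obtain ⟨E, hED, hE⟩ := exists_subset_scaledCount hN s D' hγ0 hγ1
  have hdev0 := Finset.sum_nonneg fun x (_ : x ∈ Finset.univ) => abs_nonneg (deviation μ s D' x)
  have hm2 := frac_nonneg D'
  have hlow : γ * frac D' - d ≤ frac E := by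
    rw [← sum_scaledCount s D', ← sum_scaledCount s E]
    have h2 := Finset.sum_le_sum fun x (_ : x ∈ Finset.univ) => (hE x).1
    rw [Finset.sum_sub_distrib, ← Finset.mul_sum] at h2
    simp only [Finset.sum_const, Finset.card_univ, nsmul_eq_mul] at h2
    rw [hd]
    linarith [mul_one_div (Fintype.card S : ℝ) (N : ℝ)]
  have hup : frac E ≤ γ * frac D' := by
    rw [← sum_scaledCount s D', ← sum_scaledCount s E, Finset.mul_sum]
    exact Finset.sum_le_sum fun x _ => (hE x).2
  have hdevE : ∑ x, |deviation μ s E x| ≤ γ * ∑ x, |deviation μ s D' x| + 2 * d := by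
    have h2 : ∀ x, |deviation μ s E x| ≤ γ * |deviation μ s D' x| + 1 / N + d * μ x := fun x => by
      have h3 : deviation μ s E x = γ * deviation μ s D' x
          + (scaledCount s E x - γ * scaledCount s D' x) + (γ * frac D' - frac E) * μ x := by
        simp only [deviation]
        ring
      have h4 : |(scaledCount s E x - γ * scaledCount s D' x)| ≤ 1 / N := by
        have h4a := hE x
        have h4b : (0 : ℝ) ≤ 1 / N := by positivity
        rw [abs_le]
        constructor <;> linarith
      have h5 : |(γ * frac D' - frac E) * μ x| ≤ d * μ x := by
        rw [abs_mul, abs_of_nonneg (hμ0 x), abs_of_nonneg (by linarith)]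
        exact mul_le_mul_of_nonneg_right (by linarith) (hμ0 x)
      rw [h3]
      refine (abs_add_three _ _ _).trans ?_
      rw [abs_mul, abs_of_nonneg hγ0]
      linarith
    refine (Finset.sum_le_sum fun x _ => h2 x).trans_eq ?_
    rw [Finset.sum_add_distrib, Finset.sum_add_distrib, ← Finset.mul_sum, ← Finset.mul_sum, hμ1,
      Finset.sum_const, Finset.card_univ, nsmul_eq_mul, mul_one_div, ← hd]
    ring
  have hslackE : 0 ≤ slack α μ s E := by
    have h2 : β * (1 - frac D') - 1 / 2 * ∑ x, |deviation μ s D' x| = -ε := by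
      rw [hε, neg_neg]
      rfl
    rw [slack_eq]
    change 0 ≤ β * (1 - frac E) - 1 / 2 * ∑ x, |deviation μ s E x|
    nlinarith
  have hDE := frac_mono ((h.2 h1).2 E ⟨hED, hslackE⟩)
  have h5 : (1 - γ) * frac D' ≤ 1 - γ := mul_le_of_le_one_right (by linarith) hm1
  -- One `d` comes from `1 - γ`, the other from rounding in `hlow`.
  have h6 : (1 - γ) * β ≤ ε + d := by nlinarith
  nlinarith

end FocusSets

/-! ### The single-armed policy -/

section ArmPolicy

variable {S : Type*}

theorem mean_armPolicy (y : S → Bool → ℝ≥0) (s : S) (f : Bool → ℝ) :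
    mean (armPolicy y s) f = ∑ a, (armProb y s a : ℝ) * f a := by
  simp [mean, armPolicy]

theorem sum_armProb (y : S → Bool → ℝ≥0) (s : S) : ∑ a, (armProb y s a : ℝ) = 1 := by
  exact_mod_cast congrArg NNReal.toReal (armProb_sum y s)

theorem armProb_le_one (y : S → Bool → ℝ≥0) (s : S) (a : Bool) : (armProb y s a : ℝ) ≤ 1 := by
  rw [← sum_armProb y s]
  exact Finset.single_le_sum (f := fun a => (armProb y s a : ℝ)) (fun _ _ => NNReal.coe_nonneg _)
    (Finset.mem_univ a)

/-- The default `1/2` is harmless: it occurs only where `y s` vanishes. -/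
theorem sum_mul_armProb (y : S → Bool → ℝ≥0) (s : S) (a : Bool) :
    (∑ a', (y s a' : ℝ)) * armProb y s a = y s a := by
  rw [Fintype.sum_bool, ← NNReal.coe_add, ← NNReal.coe_mul, NNReal.coe_inj, armProb]
  split_ifs with h
  · rw [add_comm, mul_div_cancel₀ _ h.ne']
  · have h0 : y s false + y s true = 0 := le_antisymm (not_lt.1 h) zero_le
    obtain ⟨h1, h2⟩ := add_eq_zero.1 h0
    cases a <;> simp [h1, h2]

variable [Fintype S] [DecidableEq S]

omit [Fintype S] [DecidableEq S] in
theorem armMatrix_eq_mean (M : SingleArmedMDP S) (y : S → Bool → ℝ≥0) (s s' : S) :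
    armMatrix M y s s' = mean (armPolicy y s) fun a => (M.P s a s').toReal := by
  rw [mean_armPolicy]
  rfl

theorem armMatrix_mem_rowStochastic (M : SingleArmedMDP S) (y : S → Bool → ℝ≥0) :
    armMatrix M y ∈ Matrix.rowStochastic ℝ S := by
  refine Matrix.mem_rowStochastic_iff_sum.2 ⟨fun s s' => ?_, fun s => ?_⟩
  · rw [armMatrix_eq_mean]
    exact le_mean_of_forall fun _ _ => ENNReal.toReal_nonneg
  · simp only [armMatrix_eq_mean]
    rw [← mean_sum]
    simp only [sum_toReal_eq_one]
    exact mean_const _ _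

omit [DecidableEq S] in
theorem LPFeasible.isStationaryDistribution {M : SingleArmedMDP S} {α : ℝ} {y : S → Bool → ℝ≥0}
    (h : LPFeasible M α y) :
    IsStationaryDistribution (armMatrix M y) fun s => ∑ a, (y s a : ℝ) where
  nonneg s := Finset.sum_nonneg fun _ _ => NNReal.coe_nonneg _
  total := h.total
  stationary s' := by
    rw [← h.flow s']
    refine Finset.sum_congr rfl fun s _ => ?_
    rw [armMatrix, Matrix.of_apply, Finset.mul_sum]
    refine Finset.sum_congr rfl fun a _ => ?_
    rw [← mul_assoc, sum_mul_armProb]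

/-- An LP solution factors through its single-armed policy and the stationary distribution. -/
theorem LPFeasible.eq_mul_armProb {M : SingleArmedMDP S} {α : ℝ} {y : S → Bool → ℝ≥0}
    (h : LPFeasible M α y) (hchain : IsAperiodicUnichain (armMatrix M y)) {μ : S → ℝ}
    (hμ : IsStationaryDistribution (armMatrix M y) μ) (s : S) (a : Bool) :
    (y s a : ℝ) = μ s * armProb y s a := by
  rw [hμ.unique (armMatrix_mem_rowStochastic M y) hchain h.isStationaryDistribution,
    sum_mul_armProb]

end ArmPolicy

/-! ### One step of the set-expansion policy -/

section OneStep

variable {S : Type*} [Fintype S] [DecidableEq S] {N : ℕ}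

-- Since `v` has mass zero, `p` may be centred at `1/2`. This saves the factor `2` that matches the
-- `1/2` in the slack.
omit [DecidableEq S] in
theorem abs_sum_mul_le_half {v p : S → ℝ} (hv : ∑ s, v s = 0) (hp0 : ∀ s, 0 ≤ p s)
    (hp1 : ∀ s, p s ≤ 1) : |∑ s, v s * p s| ≤ 1 / 2 * ∑ s, |v s| := by
  have h : ∑ s, v s * p s = ∑ s, v s * (p s - 1 / 2) := by
    simp only [mul_sub, Finset.sum_sub_distrib, ← Finset.sum_mul, hv]
    ring
  rw [h, Finset.mul_sum]
  refine (Finset.abs_sum_le_sum_abs _ _).trans (Finset.sum_le_sum fun s _ => ?_)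
  rw [abs_mul, mul_comm]
  refine mul_le_mul_of_nonneg_right ?_ (abs_nonneg _)
  rw [abs_le]
  constructor <;> linarith [hp0 s, hp1 s]

theorem average_eq_sum_scaledCount (s : Fin N → S) (D : Finset (Fin N)) (g : S → ℝ) :
    (1 / (N : ℝ)) * ∑ i ∈ D, g (s i) = ∑ x, scaledCount s D x * g x := by
  rw [← Finset.sum_fiberwise_of_maps_to (t := Finset.univ) (g := s) fun _ _ => Finset.mem_univ _,
    Finset.mul_sum]
  refine Finset.sum_congr rfl fun x _ => ?_
  rw [Finset.sum_congr rfl (g := fun _ => g x) fun i hi => by rw [(Finset.mem_filter.1 hi).2],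
    Finset.sum_const, nsmul_eq_mul, scaledCount, mul_assoc]

theorem sum_scaledCount_mul (μ : S → ℝ) (s : Fin N → S) (D : Finset (Fin N)) (g : S → ℝ) :
    ∑ x, scaledCount s D x * g x = frac D * ∑ x, μ x * g x + ∑ x, deviation μ s D x * g x := by
  rw [Finset.mul_sum, ← Finset.sum_add_distrib]
  refine Finset.sum_congr rfl fun x _ => ?_
  rw [deviation]
  ring

/-- The number of arms of `D` that do not follow the ideal actions `b`. -/
def mismatches (D : Finset (Fin N)) (b a : Fin N → Bool) : ℕ :=
  (D.filter fun i => a i ≠ b i).card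

theorem pulls_add_idle (D : Finset (Fin N)) (b : Fin N → Bool) :
    pulls D b + (D.filter fun i => b i = false).card = D.card := by
  rw [pulls, ← Finset.card_filter_add_card_filter_not (s := D) fun i => b i = true]
  simp

/-- The number of mismatches is the distance of the number of ideal pulls to the feasible range. -/
theorem mismatches_le {B : ℕ} {D : Finset (Fin N)} {b a : Fin N → Bool}
    (ha : a ∈ rectifiedActions B D b) {e : ℝ} (he1 : e ≤ B) (he2 : (B : ℝ) - (N - D.card) ≤ e) :
    (mismatches D b a : ℝ) ≤ |(pulls D b : ℝ) - e| := by
  -- The range of ideal pulls that can be served is `[B - (N - |D|), B]`. In the three cases `pulls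
  -- D b` lies above it, below it or inside it, and the mismatches number at most the distance to
  -- it, hence at most the distance to its point `e`.
  unfold rectifiedActions at ha
  split_ifs at ha with h1 h2
  · simp only [Finset.mem_filter, Finset.mem_univ, true_and] at ha
    have hsub : (Finset.univ.filter fun i => a i = true) ⊆ D.filter fun i => b i = true :=
      fun i hi => Finset.mem_filter.2 (ha.2 i (Finset.mem_filter.1 hi).2)
    have hmis : mismatches D b a + B ≤ pulls D b := by
      have h3 : (D.filter fun i => a i ≠ b i) ⊆
          (D.filter fun i => b i = true) \ Finset.univ.filter fun i => a i = true := fun i hi => by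
        simp only [Finset.mem_filter, Finset.mem_sdiff, Finset.mem_univ, true_and] at hi ⊢
        have h4 := ha.2 i
        rcases Bool.eq_false_or_eq_true (a i) with h | h <;>
          rcases Bool.eq_false_or_eq_true (b i) with h' | h' <;> simp_all
      have h5 := Finset.card_le_card h3
      have h6 := Finset.card_le_card hsub
      rw [Finset.card_sdiff_of_subset hsub] at h5
      have h7 : (Finset.univ.filter fun i => a i = true).card = B := ha.1
      unfold mismatches pulls
      omega
    have hmis' : (mismatches D b a : ℝ) + B ≤ pulls D b := by exact_mod_cast hmis
    exact le_trans (by linarith) (le_abs_self _)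
  · simp only [Finset.mem_filter, Finset.mem_univ, true_and] at ha
    have hsub : (Finset.univ.filter fun i => a i = false) ⊆ D.filter fun i => b i = false :=
      fun i hi => Finset.mem_filter.2 (ha.2 i (Finset.mem_filter.1 hi).2)
    have hD := pulls_add_idle D b
    have hU := pulls_add_idle Finset.univ a
    rw [ha.1, Finset.card_univ, Fintype.card_fin] at hU
    have hmis : mismatches D b a + N + pulls D b ≤ D.card + B := by
      have h3 : (D.filter fun i => a i ≠ b i) ⊆
          (D.filter fun i => b i = false) \ Finset.univ.filter fun i => a i = false :=
        fun i hi => by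
        simp only [Finset.mem_filter, Finset.mem_sdiff, Finset.mem_univ, true_and] at hi ⊢
        have h4 := ha.2 i
        rcases Bool.eq_false_or_eq_true (a i) with h | h <;>
          rcases Bool.eq_false_or_eq_true (b i) with h' | h' <;> simp_all
      have h5 := Finset.card_le_card h3
      have h6 := Finset.card_le_card hsub
      rw [Finset.card_sdiff_of_subset hsub] at h5
      unfold mismatches
      omega
    have hmis' : (mismatches D b a : ℝ) + N + pulls D b ≤ D.card + B := by exact_mod_cast hmis
    exact le_trans (by linarith) (neg_le_abs _)
  · simp only [Finset.mem_filter, Finset.mem_univ, true_and] at ha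
    have h0 : mismatches D b a = 0 := by
      rw [mismatches, Finset.card_eq_zero, Finset.filter_eq_empty_iff]
      exact fun i hi => not_not.2 (ha.1.2 i hi)
    rw [h0, Nat.cast_zero]
    exact abs_nonneg _

/-- The joint law of the ideal actions and the rectified actions for the focus set `D`. -/
noncomputable def focusActions (y : S → Bool → ℝ≥0) {B : ℕ} (hB : B ≤ N) (s : Fin N → S)
    (D : Finset (Fin N)) : PMF ((Fin N → Bool) × (Fin N → Bool)) :=
  (indepLaw fun i => armPolicy y (s i)).bind fun b =>
    (PMF.uniformOfFinset (rectifiedActions B D b) (rectifiedActions_nonempty hB D b)).map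
      fun a => (b, a)

omit [Fintype S] [DecidableEq S] in
theorem mem_rectifiedActions_of_mem_support {y : S → Bool → ℝ≥0} {B : ℕ} {hB : B ≤ N}
    {s : Fin N → S} {D : Finset (Fin N)} {z : (Fin N → Bool) × (Fin N → Bool)}
    (hz : z ∈ (focusActions y hB s D).support) : z.2 ∈ rectifiedActions B D z.1 := by
  rw [focusActions, PMF.mem_support_bind_iff] at hz
  obtain ⟨b, _, hb⟩ := hz
  rw [PMF.mem_support_map_iff] at hb
  obtain ⟨a, ha, rfl⟩ := hb
  exact (PMF.mem_support_uniformOfFinset_iff _ _).1 ha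

omit [Fintype S] [DecidableEq S] in
theorem mean_focusActions_fst (y : S → Bool → ℝ≥0) {B : ℕ} (hB : B ≤ N)
    (s : Fin N → S) (D : Finset (Fin N)) (f : (Fin N → Bool) → ℝ) :
    mean (focusActions y hB s D) (fun z => f z.1)
      = mean (indepLaw fun i => armPolicy y (s i)) f := by
  simp only [focusActions, mean_bind, mean_map, mean_const]

theorem natCast_mul_frac (hN : 0 < N) (D : Finset (Fin N)) : (N : ℝ) * frac D = D.card := by
  have hN' : (N : ℝ) ≠ 0 := Nat.cast_ne_zero.2 hN.ne'
  rw [frac, mul_div_cancel₀ _ hN']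

/-- The purpose of the slack condition. Per `N`, the expected number of ideal pulls in `D` is `α
m(D)` plus an error of at most `½‖v‖₁ ≤ β (1 - m(D))`. The upper end needs `β ≤ α` and the lower end
`β ≤ 1 - α`. -/
theorem sum_armProb_mem_range {μ : S → ℝ} (hN : 0 < N) {α : ℝ} {B : ℕ} (hB : (B : ℝ) = α * N)
    {y : S → Bool → ℝ≥0} (hμ1 : ∑ x, μ x = 1) (hα : ∑ x, μ x * (armProb y x true : ℝ) = α)
    {s : Fin N → S} {D : Finset (Fin N)} (hD : 0 ≤ slack α μ s D) :
    ∑ i ∈ D, (armProb y (s i) true : ℝ) ≤ B ∧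
      (B : ℝ) - (N - D.card) ≤ ∑ i ∈ D, (armProb y (s i) true : ℝ) := by
  have hN' : (0 : ℝ) < N := Nat.cast_pos.2 hN
  have h1 := average_eq_sum_scaledCount s D fun x => (armProb y x true : ℝ)
  rw [sum_scaledCount_mul μ, hα, one_div, inv_mul_eq_iff_eq_mul₀ hN'.ne'] at h1
  have h2 := abs_le.1 (abs_sum_mul_le_half (sum_deviation hμ1 s D)
    (fun x => NNReal.coe_nonneg (armProb y x true)) fun x => armProb_le_one y x true)
  rw [slack_eq] at hD
  have h3 := natCast_mul_frac hN D
  have h4 : 0 ≤ 1 - frac D := sub_nonneg.2 (frac_le_one D)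
  have h5 := mul_le_mul_of_nonneg_right (min_le_left α (1 - α)) h4
  have h6 := mul_le_mul_of_nonneg_right (min_le_right α (1 - α)) h4
  rw [h1, hB, ← h3]
  constructor <;> nlinarith

/-- In expectation, at most `√N` arms of the focus set do not follow their ideal actions. -/
theorem mean_mismatches_le {μ : S → ℝ} (hN : 0 < N) {α : ℝ} {B : ℕ} (hB : (B : ℝ) = α * N)
    (hBN : B ≤ N) {y : S → Bool → ℝ≥0} (hμ1 : ∑ x, μ x = 1)
    (hα : ∑ x, μ x * (armProb y x true : ℝ) = α)
    {s : Fin N → S} {D : Finset (Fin N)} (hD : 0 ≤ slack α μ s D) :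
    mean (focusActions y hBN s D) (fun z => (mismatches D z.1 z.2 : ℝ)) ≤ Real.sqrt N := by
  obtain ⟨h1, h2⟩ := sum_armProb_mem_range hN hB hμ1 hα hD
  refine (mean_mono fun z hz =>
    mismatches_le (mem_rectifiedActions_of_mem_support hz) h1 h2).trans ?_
  rw [mean_focusActions_fst y hBN s D fun b =>
    |(pulls D b : ℝ) - ∑ i ∈ D, (armProb y (s i) true : ℝ)|]
  have h3 := mean_indepLaw_abs_sum_le (fun i => armPolicy y (s i)) D
    (fun _ a => if a = true then 1 else 0) fun i a => by split_ifs <;> simp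
  refine le_of_eq_of_le (congrArg _ (funext fun b => ?_)) h3
  rw [Finset.sum_sub_distrib, pulls, Finset.card_filter]
  push_cast
  simp [mean_armPolicy]

omit [Fintype S] [DecidableEq S] in
theorem toReal_le_one (p : PMF S) (x : S) : (p x).toReal ≤ 1 := by
  rw [← ENNReal.toReal_one]
  exact ENNReal.toReal_mono ENNReal.one_ne_top (p.coe_le_one x)

omit [DecidableEq S] in
theorem sum_abs_sub_toReal_le (p q : PMF S) : ∑ x, |(p x).toReal - (q x).toReal| ≤ 2 := by
  calc ∑ x, |(p x).toReal - (q x).toReal| ≤ ∑ x, ((p x).toReal + (q x).toReal) := by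
        refine Finset.sum_le_sum fun x _ => ?_
        rw [abs_le]
        constructor <;>
          linarith [ENNReal.toReal_nonneg (a := p x), ENNReal.toReal_nonneg (a := q x)]
    _ = 2 := by
        rw [Finset.sum_add_distrib, sum_toReal_eq_one, sum_toReal_eq_one]
        norm_num

theorem vecMul_deviation {M : SingleArmedMDP S} {y : S → Bool → ℝ≥0} {μ : S → ℝ}
    (hμ : IsStationaryDistribution (armMatrix M y) μ) (s : Fin N → S) (D : Finset (Fin N)) (x : S) :
    Matrix.vecMul (deviation μ s D) (armMatrix M y) x
      = (1 / (N : ℝ)) * ∑ i ∈ D, armMatrix M y (s i) x - frac D * μ x := by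
  rw [average_eq_sum_scaledCount s D fun z => armMatrix M y z x, ← hμ.stationary x,
    sum_scaledCount_mul μ, Matrix.vecMul, dotProduct]
  ring

omit [DecidableEq S] in
/-- The effect of the mismatches on the transition probabilities. -/
theorem sum_abs_transition_sub_le (M : SingleArmedMDP S) (s : Fin N → S) (D : Finset (Fin N))
    (b a : Fin N → Bool) :
    ∑ x, |∑ i ∈ D, ((M.P (s i) (a i) x).toReal - (M.P (s i) (b i) x).toReal)|
      ≤ 2 * mismatches D b a := by
  calc _ ≤ ∑ x, ∑ i ∈ D, |(M.P (s i) (a i) x).toReal - (M.P (s i) (b i) x).toReal| :=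
        Finset.sum_le_sum fun x _ => Finset.abs_sum_le_sum_abs _ _
    _ = ∑ i ∈ D, ∑ x, |(M.P (s i) (a i) x).toReal - (M.P (s i) (b i) x).toReal| :=
        Finset.sum_comm
    _ ≤ ∑ i ∈ D, if a i ≠ b i then (2 : ℝ) else 0 := by
        refine Finset.sum_le_sum fun i _ => ?_
        split_ifs with h
        · exact sum_abs_sub_toReal_le _ _
        · simp [not_not.1 h]
    _ = 2 * mismatches D b a := by
        rw [← Finset.sum_filter, Finset.sum_const, nsmul_eq_mul, mismatches, mul_comm]

/-- The state counts on the focus set follow the single-armed chain up to a deviation of order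
`1 / √N` in expectation. -/
theorem mean_deviation_sub_vecMul_le {M : SingleArmedMDP S} {μ : S → ℝ} (hN : 0 < N) {α : ℝ}
    {B : ℕ} (hB : (B : ℝ) = α * N) (hBN : B ≤ N) {y : S → Bool → ℝ≥0}
    (hμ : IsStationaryDistribution (armMatrix M y) μ)
    (hα : ∑ x, μ x * (armProb y x true : ℝ) = α)
    {s : Fin N → S} {D : Finset (Fin N)} (hD : 0 ≤ slack α μ s D) :
    (mean (focusActions y hBN s D) fun z => mean (indepLaw fun i => M.P (s i) (z.2 i)) fun s' =>
      ∑ x, |deviation μ s' D x - Matrix.vecMul (deviation μ s D) (armMatrix M y) x|)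
      ≤ (2 * Fintype.card S + 2) / Real.sqrt N := by
  have hN' : (0 : ℝ) < N := Nat.cast_pos.2 hN
  -- Three sources of error: the random transitions given the actions, the mismatches, and the
  -- sampling of the ideal actions. In expectation the sums contribute at most `|S|√N`, `2√N` and
  -- `|S|√N`.
  have hpt : ∀ (z : (Fin N → Bool) × (Fin N → Bool)) (s' : Fin N → S),
      ∑ x, |deviation μ s' D x - Matrix.vecMul (deviation μ s D) (armMatrix M y) x|
        ≤ (1 / (N : ℝ)) * (∑ x, |∑ i ∈ D, ((if s' i = x then 1 else 0)
            - mean (M.P (s i) (z.2 i)) fun w => if w = x then 1 else 0)|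
          + (2 * mismatches D z.1 z.2
          + ∑ x, |∑ i ∈ D, ((M.P (s i) (z.1 i) x).toReal
            - mean (armPolicy y (s i)) fun a => (M.P (s i) a x).toReal)|)) := fun z s' => by
    have hx : ∀ x, |deviation μ s' D x - Matrix.vecMul (deviation μ s D) (armMatrix M y) x|
        ≤ (1 / (N : ℝ)) * (|∑ i ∈ D, ((if s' i = x then 1 else 0)
            - mean (M.P (s i) (z.2 i)) fun w => if w = x then 1 else 0)|
          + (|∑ i ∈ D, ((M.P (s i) (z.2 i) x).toReal - (M.P (s i) (z.1 i) x).toReal)|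
          + |∑ i ∈ D, ((M.P (s i) (z.1 i) x).toReal
            - mean (armPolicy y (s i)) fun a => (M.P (s i) a x).toReal)|)) := fun x => by
      have heq : deviation μ s' D x - Matrix.vecMul (deviation μ s D) (armMatrix M y) x
          = (1 / (N : ℝ)) * (∑ i ∈ D, ((if s' i = x then 1 else 0)
            - mean (M.P (s i) (z.2 i)) fun w => if w = x then 1 else 0)
          + (∑ i ∈ D, ((M.P (s i) (z.2 i) x).toReal - (M.P (s i) (z.1 i) x).toReal)
          + ∑ i ∈ D, ((M.P (s i) (z.1 i) x).toReal
            - mean (armPolicy y (s i)) fun a => (M.P (s i) a x).toReal))) := by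
        rw [vecMul_deviation hμ, deviation, scaledCount, Finset.card_filter]
        simp only [mean_indicator_eq, Finset.sum_sub_distrib, armMatrix_eq_mean]
        push_cast
        ring
      rw [heq, abs_mul, abs_of_pos (by positivity : (0 : ℝ) < 1 / N)]
      refine mul_le_mul_of_nonneg_left ?_ (by positivity)
      exact (abs_add_le _ _).trans (by gcongr; exact abs_add_le _ _)
    refine (Finset.sum_le_sum fun x _ => hx x).trans ?_
    rw [← Finset.mul_sum, Finset.sum_add_distrib, Finset.sum_add_distrib]
    gcongr
    exact sum_abs_transition_sub_le M s D z.1 z.2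
  refine (mean_mono fun z _ => mean_mono fun s' _ => hpt z s').trans ?_
  simp only [mean_const_mul, mean_add, mean_const]
  have h1 : ∀ z : (Fin N → Bool) × (Fin N → Bool),
      (mean (indepLaw fun i => M.P (s i) (z.2 i)) fun s' =>
        ∑ x, |∑ i ∈ D, ((if s' i = x then 1 else 0)
            - mean (M.P (s i) (z.2 i)) fun w => if w = x then 1 else 0)|)
      ≤ Fintype.card S * Real.sqrt N := fun z => by
    rw [mean_sum]
    refine (Finset.sum_le_sum fun x _ => mean_indepLaw_abs_sum_le
      (fun i => M.P (s i) (z.2 i)) D (fun _ w => if w = x then 1 else 0)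
      fun i w => by split_ifs <;> simp).trans_eq ?_
    rw [Finset.sum_const, Finset.card_univ, nsmul_eq_mul]
  have h2 := mean_mismatches_le hN hB hBN hμ.total hα hD
  have h3 : (mean (focusActions y hBN s D) fun z =>
      ∑ x, |∑ i ∈ D, ((M.P (s i) (z.1 i) x).toReal
            - mean (armPolicy y (s i)) fun a => (M.P (s i) a x).toReal)|)
      ≤ Fintype.card S * Real.sqrt N := by
    rw [mean_focusActions_fst y hBN s D fun b => ∑ x, |∑ i ∈ D, ((M.P (s i) (b i) x).toReal
            - mean (armPolicy y (s i)) fun a => (M.P (s i) a x).toReal)|, mean_sum]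
    refine (Finset.sum_le_sum fun x _ => mean_indepLaw_abs_sum_le
      (fun i => armPolicy y (s i)) D (fun i a => (M.P (s i) a x).toReal) fun i a => ?_).trans_eq ?_
    · rw [abs_of_nonneg ENNReal.toReal_nonneg]
      exact toReal_le_one _ _
    · rw [Finset.sum_const, Finset.card_univ, nsmul_eq_mul]
  have h4 := mean_le_of_forall (p := focusActions y hBN s D) fun z _ => h1 z
  calc _ ≤ (1 / (N : ℝ)) * (Fintype.card S * Real.sqrt N + (2 * Real.sqrt N
        + Fintype.card S * Real.sqrt N)) := by gcongr
    _ = (2 * Fintype.card S + 2) / Real.sqrt N := by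
        have h5 := Real.sq_sqrt hN'.le
        have h6 := Real.sqrt_pos.2 hN'
        field_simp
        rw [h5]
        ring

/-- The expected reward for the focus set `D` is close to the value of the linear program if `D`
contains most of the arms. -/
theorem lpObjective_sub_le_mean_reward {M : SingleArmedMDP S} {μ : S → ℝ} (hN : 0 < N) {α : ℝ}
    {B : ℕ} (hB : (B : ℝ) = α * N) (hBN : B ≤ N) {y : S → Bool → ℝ≥0}
    (hμ0 : ∀ x, 0 ≤ μ x) (hμ1 : ∑ x, μ x = 1) (hy : ∀ x a, (y x a : ℝ) = μ x * armProb y x a)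
    (hα : ∑ x, μ x * (armProb y x true : ℝ) = α)
    {s : Fin N → S} {D : Finset (Fin N)} (hD : 0 ≤ slack α μ s D) :
    lpObjective M y - M.rmax * (2 / Real.sqrt N + 3 * (1 - frac D))
      ≤ mean (focusActions y hBN s D) fun z => (1 / (N : ℝ)) * ∑ i, M.r (s i) (z.2 i) := by
  have hN' : (0 : ℝ) < N := Nat.cast_pos.2 hN
  have hr := rmax_nonneg M
  have hm : 0 ≤ 1 - frac D := sub_nonneg.2 (frac_le_one D)
  -- The term `3 (1 - m(D))` collects the arms outside `D`, the factor `m(D)` in front of the LP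
  -- value, and the deviation on `D`, for which `‖v‖₁ ≤ 2β (1 - m(D)) ≤ 1 - m(D)`. Each mismatch
  -- costs at most twice `rmax`.
  have hpt : ∀ z : (Fin N → Bool) × (Fin N → Bool),
      (1 / (N : ℝ)) * ∑ i ∈ D, M.r (s i) (z.1 i)
        - (M.rmax * (1 - frac D) + (2 * M.rmax * (1 / N)) * mismatches D z.1 z.2)
      ≤ (1 / (N : ℝ)) * ∑ i, M.r (s i) (z.2 i) := fun z => by
    have h1 : -(M.rmax * (N - D.card)) ≤ ∑ i ∈ Dᶜ, M.r (s i) (z.2 i) := by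
      have h2 := Finset.sum_le_sum fun i (_ : i ∈ Dᶜ) =>
        (abs_le.1 (abs_reward_le M (s i) (z.2 i))).1
      rw [Finset.sum_const, Finset.card_compl, Fintype.card_fin, nsmul_eq_mul,
        Nat.cast_sub ((Finset.card_le_univ D).trans_eq (Fintype.card_fin N))] at h2
      linarith
    have h3 : ∑ i ∈ D, M.r (s i) (z.1 i) - 2 * M.rmax * mismatches D z.1 z.2
        ≤ ∑ i ∈ D, M.r (s i) (z.2 i) := by
      have h4 : ∑ i ∈ D, (M.r (s i) (z.1 i) - M.r (s i) (z.2 i))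
          ≤ ∑ i ∈ D, if z.2 i ≠ z.1 i then 2 * M.rmax else 0 := by
        refine Finset.sum_le_sum fun i _ => ?_
        split_ifs with h
        · linarith [(abs_le.1 (abs_reward_le M (s i) (z.1 i))).2,
            (abs_le.1 (abs_reward_le M (s i) (z.2 i))).1]
        · simp [not_not.1 h]
      rw [← Finset.sum_filter, Finset.sum_const, nsmul_eq_mul, Finset.sum_sub_distrib] at h4
      have h5 : ((D.filter fun i => z.2 i ≠ z.1 i).card : ℝ) = mismatches D z.1 z.2 := rfl
      rw [h5] at h4
      linarith
    rw [← Finset.sum_add_sum_compl D fun i => M.r (s i) (z.2 i)]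
    have h6 : M.rmax * (1 - frac D) = (1 / (N : ℝ)) * (M.rmax * (N - D.card)) := by
      rw [frac]
      field_simp
    have h7 := mul_le_mul_of_nonneg_left (add_le_add h3 h1) (by positivity : (0 : ℝ) ≤ 1 / N)
    rw [h6]
    linarith
  refine le_trans ?_ (mean_mono fun z _ => hpt z)
  rw [mean_sub, mean_add, mean_const, mean_focusActions_fst y hBN s D
    fun b => (1 / (N : ℝ)) * ∑ i ∈ D, M.r (s i) (b i), mean_const_mul, mean_const_mul, mean_sum]
  have hind : ∀ i, mean (indepLaw fun i => armPolicy y (s i)) (fun b => M.r (s i) (b i))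
      = mean (armPolicy y (s i)) fun a => M.r (s i) a := fun i =>
    mean_indepLaw_apply (fun i => armPolicy y (s i)) i fun a => M.r (s i) a
  simp only [hind]
  rw [average_eq_sum_scaledCount s D fun x => mean (armPolicy y x) fun a => M.r x a,
    sum_scaledCount_mul μ]
  have hobj : ∑ x, μ x * (mean (armPolicy y x) fun a => M.r x a) = lpObjective M y := by
    rw [lpObjective]
    refine Finset.sum_congr rfl fun x _ => ?_
    rw [mean_armPolicy, Finset.mul_sum]
    refine Finset.sum_congr rfl fun a _ => ?_
    rw [hy]
    ring
  have hrb : ∀ x, |mean (armPolicy y x) fun a => M.r x a| ≤ M.rmax := fun x =>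
    (abs_mean_le _ _).trans (mean_le_of_forall fun a _ => abs_reward_le M x a)
  have hobj_le : lpObjective M y ≤ M.rmax := by
    rw [← hobj, ← mul_one M.rmax, ← hμ1, Finset.mul_sum]
    refine Finset.sum_le_sum fun x _ => ?_
    rw [mul_comm]
    exact mul_le_mul_of_nonneg_right (abs_le.1 (hrb x)).2 (hμ0 x)
  have hdev : -(M.rmax * (1 - frac D))
      ≤ ∑ x, deviation μ s D x * mean (armPolicy y x) fun a => M.r x a := by
    have h1 : |∑ x, deviation μ s D x * mean (armPolicy y x) fun a => M.r x a|
        ≤ (∑ x, |deviation μ s D x|) * M.rmax := by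
      rw [Finset.sum_mul]
      refine (Finset.abs_sum_le_sum_abs _ _).trans (Finset.sum_le_sum fun x _ => ?_)
      rw [abs_mul]
      exact mul_le_mul_of_nonneg_left (hrb x) (abs_nonneg _)
    have h2 : ∑ x, |deviation μ s D x| ≤ 1 - frac D := by
      rw [slack_eq] at hD
      have h3 : min α (1 - α) ≤ 1 / 2 := by
        rcases le_total α (1 - α) with h | h
        · rw [min_eq_left h]
          linarith
        · rw [min_eq_right h]
          linarith
      nlinarith
    have h4 := mul_le_mul_of_nonneg_right h2 hr
    linarith [(abs_le.1 h1).1]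
  have hmis := mul_le_mul_of_nonneg_left (mean_mismatches_le hN hB hBN hμ1 hα hD)
    (by positivity : 0 ≤ 2 * M.rmax * (1 / (N : ℝ)))
  have hsq : 2 * M.rmax * (1 / (N : ℝ)) * Real.sqrt N = M.rmax * (2 / Real.sqrt N) := by
    have h5 := Real.sq_sqrt hN'.le
    have h6 := Real.sqrt_pos.2 hN'
    field_simp
    rw [h5]
  rw [hsq] at hmis
  rw [hobj]
  have h8 := mul_le_mul_of_nonneg_right hobj_le hm
  linarith

end OneStep

/-! ### The drift of the Lyapunov function -/

section Drift

variable {S : Type*} [Fintype S] [DecidableEq S] {N : ℕ}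

omit [DecidableEq S] in
theorem IsWeightedNorm.nonneg [Nonempty S] {Q : Matrix S S ℝ} {lam : ℝ} {h : (S → ℝ) → ℝ}
    (hh : IsWeightedNorm Q lam h) (v : S → ℝ) : 0 ≤ h v :=
  (abs_nonneg _).trans (hh.abs_le v (Classical.arbitrary S))

/-- The Lyapunov function of the set-expansion policy for the focus set `D` and the state
vector `s`. -/
noncomputable def lyapunov (α : ℝ) (μ : S → ℝ) (lam : ℝ) (h : (S → ℝ) → ℝ)
    (x : Finset (Fin N) × (Fin N → S)) : ℝ :=
  h (deviation μ x.2 x.1) + 2 * Real.sqrt lam * (1 - frac x.1)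
    + 4 * Real.sqrt lam / min α (1 - α) * max (-slack α μ x.2 x.1) 0

theorem lyapunov_nonneg [Nonempty S] {Q : Matrix S S ℝ} {α lam : ℝ} {h : (S → ℝ) → ℝ}
    (hh : IsWeightedNorm Q lam h) (hα0 : 0 < α) (hα1 : α < 1) (μ : S → ℝ)
    (x : Finset (Fin N) × (Fin N → S)) : 0 ≤ lyapunov α μ lam h x := by
  have h1 := hh.nonneg (deviation μ x.2 x.1)
  have h2 : 0 ≤ 1 - frac x.1 := sub_nonneg.2 (frac_le_one _)
  have h3 : 0 < min α (1 - α) := lt_min hα0 (by linarith)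
  have h4 := le_max_right (-slack α μ x.2 x.1) 0
  unfold lyapunov
  positivity

/-- An update of the focus set increases the Lyapunov function by little. -/
theorem IsFocusUpdate.lyapunov_le {Q : Matrix S S ℝ} {α lam : ℝ} {h : (S → ℝ) → ℝ}
    (hh : IsWeightedNorm Q lam h) (hN : 0 < N) (hα0 : 0 < α) (hα1 : α < 1) {μ : S → ℝ}
    (hμ0 : ∀ x, 0 ≤ μ x) (hμ1 : ∑ x, μ x = 1) {s : Fin N → S} {D' D : Finset (Fin N)}
    (hD : IsFocusUpdate α μ s D' D) :
    h (deviation μ s D) + 2 * Real.sqrt lam * (1 - frac D)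
      ≤ lyapunov α μ lam h (D', s)
        + 8 * Real.sqrt lam * (Fintype.card S / N) / min α (1 - α) := by
  have hβ0 : 0 < min α (1 - α) := lt_min hα0 (by linarith)
  have hl := Real.sqrt_nonneg lam
  have hψ := le_max_right (-slack α μ s D') 0
  have hbound : ∀ F : Finset (Fin N), Real.sqrt lam * ∑ x, |deviation μ s F x|
      ≤ Real.sqrt lam * (2 * frac F) := fun F =>
    mul_le_mul_of_nonneg_left (sum_abs_deviation_le hμ0 hμ1 s F) hl
  rw [lyapunov]
  rcases hD.subset_or_subset with hsub | hsub
  -- Expansion: `h` grows by at most `2√λ m(D \ D')`, which the drop of `2√λ (1 - m)` cancels.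
  · have hun : D' ∪ D \ D' = D := Finset.union_sdiff_of_subset hsub
    have h1 := hh.add_le (deviation μ s D') (deviation μ s (D \ D'))
    rw [← deviation_union μ s Finset.disjoint_sdiff, hun] at h1
    have h2 := frac_union (Finset.disjoint_sdiff (s := D') (t := D))
    rw [hun] at h2
    have h3 := (hh.le_sum (deviation μ s (D \ D'))).trans (hbound _)
    have h4 : 0 ≤ 4 * Real.sqrt lam / min α (1 - α) * max (-slack α μ s D') 0 := by positivity
    have h5 : 0 ≤ 8 * Real.sqrt lam * (Fintype.card S / N) / min α (1 - α) := by positivity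
    simp only
    nlinarith
  -- Shrinking: both terms grow, by at most `4√λ m(D' \ D)` together. The bound on the shrinkage
  -- converts this into the slack term of `lyapunov`, whence its coefficient `4√λ/β`.
  · have hun : D ∪ D' \ D = D' := Finset.union_sdiff_of_subset hsub
    have h0 := deviation_union μ s (Finset.disjoint_sdiff (s := D) (t := D'))
    rw [hun] at h0
    have h1 := hh.add_le (deviation μ s D') (-deviation μ s (D' \ D))
    rw [h0, add_neg_cancel_right, ← h0] at h1
    have h2 := frac_union (Finset.disjoint_sdiff (s := D) (t := D'))
    rw [hun] at h2
    have h3 := hh.le_sum (-deviation μ s (D' \ D))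
    simp only [Pi.neg_apply, abs_neg] at h3
    have h4 := h3.trans (hbound _)
    have h5 := mul_le_mul_of_nonneg_left (hD.shrink_le hN hα0 hα1 hμ0 hμ1)
      (by positivity : 0 ≤ 4 * Real.sqrt lam)
    have h6 : 4 * Real.sqrt lam * ((max (-slack α μ s D') 0 + 2 * (Fintype.card S / N)) /
        min α (1 - α)) = 4 * Real.sqrt lam / min α (1 - α) * max (-slack α μ s D') 0
        + 8 * Real.sqrt lam * (Fintype.card S / N) / min α (1 - α) := by ring
    rw [h6] at h5
    simp only
    nlinarith

/-- The Lyapunov function after one transition of the arms, in terms of the deviation from the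
single-armed chain. -/
theorem lyapunov_step_le {M : SingleArmedMDP S} {y : S → Bool → ℝ≥0} {α lam : ℝ}
    {h : (S → ℝ) → ℝ} (hh : IsWeightedNorm (armMatrix M y) lam h) (hα0 : 0 < α) (hα1 : α < 1)
    {μ : S → ℝ} (hμ1 : ∑ x, μ x = 1) {s : Fin N → S}
    {D : Finset (Fin N)} (hD : 0 ≤ slack α μ s D) (s' : Fin N → S) :
    lyapunov α μ lam h (D, s')
      ≤ h (deviation μ s D) + 2 * Real.sqrt lam * (1 - frac D)
        - 1 / (2 * lam) * h (deviation μ s D)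
        + (Real.sqrt lam + 2 * Real.sqrt lam / min α (1 - α)) *
          ∑ x, |deviation μ s' D x - Matrix.vecMul (deviation μ s D) (armMatrix M y) x| := by
  have hβ0 : 0 < min α (1 - α) := lt_min hα0 (by linarith)
  have hl := Real.sqrt_nonneg lam
  have hsum := sum_deviation hμ1 s D
  set w := Matrix.vecMul (deviation μ s D) (armMatrix M y) with hw
  have h1 := hh.add_le w (deviation μ s' D - w)
  rw [add_sub_cancel] at h1
  have h2 := hh.contract _ hsum
  have h3 := hh.le_sum (deviation μ s' D - w)
  simp only [Pi.sub_apply] at h3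
  have h4 : ∑ x, |deviation μ s' D x| ≤ ∑ x, |deviation μ s D x|
      + ∑ x, |deviation μ s' D x - w x| := by
    have h5 := sum_abs_vecMul_le_sum_abs (armMatrix_mem_rowStochastic M y) hsum
    rw [← hw] at h5
    refine le_trans ?_ (add_le_add_left h5 _)
    rw [← Finset.sum_add_distrib]
    refine Finset.sum_le_sum fun x _ => ?_
    have h6 := abs_add_le (w x) (deviation μ s' D x - w x)
    rwa [add_sub_cancel] at h6
  set η := ∑ x, |deviation μ s' D x - w x|
  have hη : 0 ≤ η := Finset.sum_nonneg fun _ _ => abs_nonneg _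
  -- A stochastic matrix does not increase the `ℓ¹` norm, so with `D` unchanged the slack falls by
  -- at most `½ η` from a nonnegative value.
  have h7 : max (-slack α μ s' D) 0 ≤ 1 / 2 * η := by
    refine max_le ?_ (by positivity)
    rw [slack_eq] at hD ⊢
    linarith
  have h8 := mul_le_mul_of_nonneg_left h7
    (by positivity : 0 ≤ 4 * Real.sqrt lam / min α (1 - α))
  have h9 : 4 * Real.sqrt lam / min α (1 - α) * (1 / 2 * η)
      = 2 * Real.sqrt lam / min α (1 - α) * η := by ring
  rw [lyapunov]
  simp only
  linarith

/-- Here `n = √N`, `c = |S|`, `l = λ`, `b = β`, `q = √λ`. With `1/b ≥ 2`, `q ≤ l` and `1/n² ≤ 1/n`,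
the terms add up to at most `4 + 54 = 58` times `l² c² / (b² n)`, well within `252`. -/
theorem error_constant_le {n c l b q : ℝ} (hn : 1 ≤ n) (hc : 1 ≤ c) (hl : 1 ≤ l) (hb0 : 0 < b)
    (hb1 : b ≤ 1 / 2) (hq : q ^ 2 = l) (hq0 : 0 ≤ q) :
    2 / n + 3 / b * (2 / n ^ 2) + 3 * c * l / b * (8 * q * (c / n ^ 2) / b
      + (q + 2 * q / b) * ((2 * c + 2) / n)) ≤ 252 * l ^ 2 * c ^ 2 / b ^ 2 / n := by
  have hn0 : 0 < n := by linarith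
  have hq1 : 1 ≤ q := by nlinarith
  have hn2 : 1 / n ^ 2 ≤ 1 / n := by
    refine one_div_le_one_div_of_le hn0 ?_
    nlinarith
  have hb2 : 2 ≤ 1 / b := by
    rw [le_div_iff₀ hb0]
    linarith
  set u := 1 / b with hu
  set v := 1 / n with hv
  have hv0 : 0 < v := by positivity
  have hle : 2 / n + 3 / b * (2 / n ^ 2) + 3 * c * l / b * (8 * q * (c / n ^ 2) / b
      + (q + 2 * q / b) * ((2 * c + 2) / n))
      ≤ 2 * v + 3 * u * (2 * v) + 3 * c * l * u * (8 * q * (c * v) * u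
      + (q + 2 * q * u) * ((2 * c + 2) * v)) := by
    have h1 : 2 / n + 3 / b * (2 / n ^ 2) + 3 * c * l / b * (8 * q * (c / n ^ 2) / b
      + (q + 2 * q / b) * ((2 * c + 2) / n))
      = 2 * v + 3 * u * (2 * (1 / n ^ 2)) + 3 * c * l * u * (8 * q * (c * (1 / n ^ 2)) * u
      + (q + 2 * q * u) * ((2 * c + 2) * v)) := by
      rw [hu, hv]
      ring
    rw [h1]
    gcongr
  refine hle.trans ?_
  have heq : 252 * l ^ 2 * c ^ 2 / b ^ 2 / n = 252 * l ^ 2 * c ^ 2 * u ^ 2 * v := by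
    rw [hu, hv]
    ring
  rw [heq]
  have hql : q ≤ l := by nlinarith
  have h2 : 8 * q * (c * v) * u + (q + 2 * q * u) * ((2 * c + 2) * v) ≤ 18 * (q * c * u) * v := by
    have h3 : q + 2 * q * u ≤ 5 / 2 * (q * u) := by nlinarith
    have h4 : (2 * c + 2) * v ≤ 4 * c * v := by nlinarith
    have h5 : (q + 2 * q * u) * ((2 * c + 2) * v) ≤ 5 / 2 * (q * u) * (4 * c * v) := by gcongr
    linarith
  have h6 : 3 * c * l * u * (8 * q * (c * v) * u + (q + 2 * q * u) * ((2 * c + 2) * v))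
      ≤ 3 * c * l * u * (18 * (l * c * u) * v) := by
    refine mul_le_mul_of_nonneg_left (h2.trans ?_) (by positivity)
    gcongr
  have h7 : 1 ≤ l ^ 2 * c ^ 2 := one_le_mul_of_one_le_of_one_le (one_le_pow₀ hl) (one_le_pow₀ hc)
  have h8 : 2 * v + 3 * u * (2 * v) ≤ 4 * u ^ 2 * v := by
    have h9 : 2 + 6 * u ≤ 4 * u ^ 2 := by nlinarith
    nlinarith
  have h10 : 4 * u ^ 2 * v ≤ 4 * u ^ 2 * v * (l ^ 2 * c ^ 2) :=
    le_mul_of_one_le_right (by positivity) h7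
  have h11 : 0 ≤ u ^ 2 * v * (l ^ 2 * c ^ 2) := by positivity
  nlinarith

/-- The Foster–Lyapunov inequality: for the new focus set, the loss of expected reward is bounded
by the expected decrease of the Lyapunov function and an error of order `1 / √N`. -/
theorem IsFocusUpdate.lpObjective_sub_le [Nonempty S] {M : SingleArmedMDP S} {α lam : ℝ}
    {y : S → Bool → ℝ≥0} {h : (S → ℝ) → ℝ} (hh : IsWeightedNorm (armMatrix M y) lam h)
    (hN : 0 < N) (hα0 : 0 < α) (hα1 : α < 1) {B : ℕ} (hB : (B : ℝ) = α * N) (hBN : B ≤ N)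
    {μ : S → ℝ} (hμ : IsStationaryDistribution (armMatrix M y) μ)
    (hy : ∀ x a, (y x a : ℝ) = μ x * armProb y x a)
    (hα : ∑ x, μ x * (armProb y x true : ℝ) = α) {s : Fin N → S} {D' D : Finset (Fin N)}
    (hD : IsFocusUpdate α μ s D' D) :
    lpObjective M y - (mean (focusActions y hBN s D) fun z =>
        (1 / (N : ℝ)) * ∑ i, M.r (s i) (z.2 i))
      ≤ 3 * M.rmax * Fintype.card S * lam / min α (1 - α) * (lyapunov α μ lam h (D', s)
          - mean (focusActions y hBN s D) fun z => mean (indepLaw fun i => M.P (s i) (z.2 i))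
            fun s' => lyapunov α μ lam h (D, s'))
        + 252 * M.rmax * lam ^ 2 * (Fintype.card S : ℝ) ^ 2 / (min α (1 - α)) ^ 2
          / Real.sqrt N := by
  have hN1 : (1 : ℝ) ≤ N := by exact_mod_cast hN
  have hβ0 : 0 < min α (1 - α) := lt_min hα0 (by linarith)
  have hβ1 : min α (1 - α) ≤ 1 / 2 := by
    rcases le_total α (1 - α) with h | h
    · rw [min_eq_left h]
      linarith
    · rw [min_eq_right h]
      linarith
  have hl := Real.sqrt_nonneg lam
  have hlam := hh.one_le
  have hr := rmax_nonneg M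
  have hc : (1 : ℝ) ≤ Fintype.card S := by exact_mod_cast Fintype.card_pos (α := S)
  have hslack := hD.slack_nonneg
  have hdev : ∑ x, |deviation μ s D x| ≤ Fintype.card S * h (deviation μ s D) := by
    refine (Finset.sum_le_sum fun x _ => hh.abs_le _ x).trans_eq ?_
    rw [Finset.sum_const, Finset.card_univ, nsmul_eq_mul]
  have hcov := hD.coverage hN hα1 hμ.nonneg hμ.total
  have hrew := lpObjective_sub_le_mean_reward (M := M) hN hB hBN hμ.nonneg hμ.total hy hα hslack
  have hupd := hD.lyapunov_le hh hN hα0 hα1 hμ.nonneg hμ.total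
  have hstep := mean_mono (p := focusActions y hBN s D) fun z _ =>
    mean_mono (p := indepLaw fun i => M.P (s i) (z.2 i)) fun s' _ =>
      lyapunov_step_le hh hα0 hα1 hμ.total hslack s'
  simp only [mean_add, mean_const, mean_const_mul] at hstep
  have hnoise := mul_le_mul_of_nonneg_left
    (mean_deviation_sub_vecMul_le hN hB hBN hμ hα hslack)
    (by positivity : 0 ≤ Real.sqrt lam + 2 * Real.sqrt lam / min α (1 - α))
  have hconst := error_constant_le (Real.one_le_sqrt.2 hN1) hc hlam hβ0 hβ1
    (Real.sq_sqrt (zero_le_one.trans hlam)) hl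
  rw [Real.sq_sqrt (Nat.cast_nonneg N)] at hconst
  set V := mean (focusActions y hBN s D) fun z => mean (indepLaw fun i => M.P (s i) (z.2 i))
            fun s' => lyapunov α μ lam h (D, s')
  set β := min α (1 - α)
  set H := h (deviation μ s D)
  set c : ℝ := (Fintype.card S : ℝ)
  set E := 8 * Real.sqrt lam * (c / N) / β
      + (Real.sqrt lam + 2 * Real.sqrt lam / β) * ((2 * c + 2) / Real.sqrt N) with hE
  -- The update and the transition combine to an expected decrease of at least `H / (2λ) - E`; read
  -- backwards, the decrease bounds `H`, hence `‖v‖₁`, the uncovered fraction and the loss.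
  have hH : H ≤ 2 * lam * (lyapunov α μ lam h (D', s) - V + E) := by
    have h1 : 1 / (2 * lam) * H ≤ lyapunov α μ lam h (D', s) - V + E := by linarith
    rw [one_div, inv_mul_le_iff₀ (by linarith)] at h1
    exact h1
  have hm : 1 - frac D ≤ 1 / β * (1 / 2 * (c * H) + 2 / N) := by
    rw [one_div, le_inv_mul_iff₀ hβ0]
    linarith
  have hloss : lpObjective M y - (mean (focusActions y hBN s D) fun z =>
      (1 / (N : ℝ)) * ∑ i, M.r (s i) (z.2 i)) ≤ M.rmax * (2 / Real.sqrt N + 3 * (1 / β *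
        (1 / 2 * (c * (2 * lam * (lyapunov α μ lam h (D', s) - V + E))) + 2 / N))) := by
    have h2 : M.rmax * (2 / Real.sqrt N + 3 * (1 - frac D)) ≤ M.rmax * (2 / Real.sqrt N + 3 *
        (1 / β * (1 / 2 * (c * (2 * lam * (lyapunov α μ lam h (D', s) - V + E))) + 2 / N))) := by
      refine mul_le_mul_of_nonneg_left ?_ hr
      gcongr
      refine hm.trans ?_
      gcongr
    linarith
  refine hloss.trans ?_
  have h3 := mul_le_mul_of_nonneg_left hconst hr
  have h4 : M.rmax * (2 / Real.sqrt N + 3 * (1 / β *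
        (1 / 2 * (c * (2 * lam * (lyapunov α μ lam h (D', s) - V + E))) + 2 / N)))
      = 3 * M.rmax * c * lam / β * (lyapunov α μ lam h (D', s) - V)
        + M.rmax * (2 / Real.sqrt N + 3 / β * (2 / N) + 3 * c * lam / β * E) := by ring
  have h5 : 252 * M.rmax * lam ^ 2 * c ^ 2 / β ^ 2 / Real.sqrt N
      = M.rmax * (252 * lam ^ 2 * c ^ 2 / β ^ 2 / Real.sqrt N) := by ring
  rw [h4, h5]
  linarith

end Drift

/-! ### Averages along a power-bounded operator -/

section Averages

variable {E : Type*} [NormedAddCommGroup E] [NormedSpace ℝ E]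

/-- A nonzero vector in both the range and the kernel of `f - 1` would force linear growth, which
bounded powers exclude. -/
theorem pow_apply_eq_add_smul {f : E →ₗ[ℝ] E} {u w : E} (hu : f u = u) (hw : f w = w + u) (n : ℕ) :
    (f ^ n) w = w + (n : ℝ) • u := by
  induction n with
  | zero => simp
  | succ n ih =>
    rw [pow_succ', Module.End.mul_apply, ih, map_add, map_smul, hu, hw]
    push_cast
    module

/-- The mean ergodic theorem in finite dimension. -/
theorem exists_tendsto_average_pow [FiniteDimensional ℝ E] (f : E →ₗ[ℝ] E)
    (hf : ∀ (n : ℕ) (w : E), ‖(f ^ n) w‖ ≤ ‖w‖) (x : E) :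
    ∃ z, Tendsto (fun n : ℕ => (1 / (n : ℝ)) • ∑ t ∈ Finset.range n, (f ^ t) x) atTop (𝓝 z) := by
  have hdisj : Disjoint (LinearMap.range (f - 1)) (LinearMap.ker (f - 1)) := by
    rw [Submodule.disjoint_def]
    rintro u ⟨w, hw⟩ hu
    have hu' : f u = u := by simpa [sub_eq_zero] using hu
    have hw' : f w = w + u := by
      rw [← hw]
      simp
    have hbound : ∀ n : ℕ, (n : ℝ) * ‖u‖ ≤ 2 * ‖w‖ := fun n => by
      have h1 : (n : ℝ) • u = (f ^ n) w - w := by rw [pow_apply_eq_add_smul hu' hw']; abel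
      calc (n : ℝ) * ‖u‖ = ‖(n : ℝ) • u‖ := by rw [norm_smul, Real.norm_natCast]
        _ ≤ ‖(f ^ n) w‖ + ‖w‖ := by rw [h1]; exact norm_sub_le _ _
        _ ≤ 2 * ‖w‖ := by linarith [hf n w]
    by_contra hne
    obtain ⟨n, hn⟩ := exists_nat_gt (2 * ‖w‖ / ‖u‖)
    rw [div_lt_iff₀ (norm_pos_iff.2 hne)] at hn
    exact absurd (hbound n) (not_le.2 hn)
  -- By rank–nullity the disjoint range and kernel of `f - 1` span the space. Averages telescope to
  -- `0` on the range and are constant on the kernel.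
  have htop := Submodule.eq_top_of_disjoint _ _ (LinearMap.finrank_range_add_finrank_ker (f - 1)).ge
    hdisj
  obtain ⟨r, ⟨w, rfl⟩, z, hz, rfl⟩ := Submodule.mem_sup.1
    (htop.symm ▸ Submodule.mem_top : x ∈ LinearMap.range (f - 1) ⊔ LinearMap.ker (f - 1))
  have hz' : f z = z := by simpa [sub_eq_zero] using hz
  have hfix : ∀ t, (f ^ t) z = z := fun t => by
    induction t with
    | zero => simp
    | succ t ih => rw [pow_succ', Module.End.mul_apply, ih, hz']
  have hsum : ∀ n : ℕ, ∑ t ∈ Finset.range n, (f ^ t) ((f - 1) w + z)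
      = ((f ^ n) w - w) + (n : ℝ) • z := fun n => by
    have h1 : ∀ t, (f ^ t) ((f - 1) w + z) = ((f ^ (t + 1)) w - (f ^ t) w) + z := fun t => by
      rw [map_add, hfix, LinearMap.sub_apply, Module.End.one_apply, map_sub, pow_succ,
        Module.End.mul_apply]
    simp only [h1, Finset.sum_add_distrib, Finset.sum_const, Finset.card_range]
    rw [Finset.sum_range_sub fun t => (f ^ t) w, pow_zero, Module.End.one_apply, Nat.cast_smul_eq_nsmul]
  refine ⟨z, ?_⟩
  have hzero : Tendsto (fun n : ℕ => (1 / (n : ℝ)) • ((f ^ n) w - w)) atTop (𝓝 0) := by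
    refine squeeze_zero_norm (a := fun n : ℕ => 1 / (n : ℝ) * (2 * ‖w‖)) (fun n => ?_) ?_
    · rw [norm_smul, Real.norm_of_nonneg (by positivity)]
      refine mul_le_mul_of_nonneg_left ?_ (by positivity)
      exact (norm_sub_le _ _).trans (by linarith [hf n w])
    · simpa using (tendsto_one_div_atTop_nhds_zero_nat (𝕜 := ℝ)).mul_const (2 * ‖w‖)
  have hlim := hzero.add_const z
  rw [zero_add] at hlim
  refine hlim.congr' ?_
  filter_upwards [eventually_gt_atTop 0] with n hn
  have hn' : (n : ℝ) ≠ 0 := Nat.cast_ne_zero.2 hn.ne'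
  rw [hsum, smul_add, smul_smul, one_div, inv_mul_cancel₀ hn', one_smul]

end Averages

/-! ### The chain of focus sets and state vectors -/

section FocusChain

variable {S : Type*} [Fintype S] [DecidableEq S] {N : ℕ} {α : ℝ} {μ : S → ℝ}

/-- The transition law of the focus set and the state vector under the set-expansion policy. -/
noncomputable def focusStep (M : SingleArmedMDP S) (y : S → Bool → ℝ≥0) {B : ℕ} (hB : B ≤ N)
    (F : FocusRule S N α μ) (x : Finset (Fin N) × (Fin N → S)) :
    PMF (Finset (Fin N) × (Fin N → S)) :=
  (F.choose x.2 x.1).bind fun D => (focusActions y hB x.2 D).bind fun z =>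
    (indepLaw fun i => M.P (x.2 i) (z.2 i)).map fun s' => (D, s')

/-- The law of the previous focus set and the state vector at time `t`. -/
noncomputable def focusChain (M : SingleArmedMDP S) (y : S → Bool → ℝ≥0) {B : ℕ} (hB : B ≤ N)
    (F : FocusRule S N α μ) (s₀ : Fin N → S) : ℕ → PMF (Finset (Fin N) × (Fin N → S))
  | 0 => PMF.pure (∅, s₀)
  | t + 1 => (focusChain M y hB F s₀ t).bind (focusStep M y hB F)

/-- The conditional expectation of the reward at the focus set and the state vector `x`. -/
noncomputable def focusReward (M : SingleArmedMDP S) (y : S → Bool → ℝ≥0) {B : ℕ} (hB : B ≤ N)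
    (F : FocusRule S N α μ) (x : Finset (Fin N) × (Fin N → S)) : ℝ :=
  mean (F.choose x.2 x.1) fun D => mean (focusActions y hB x.2 D) fun z =>
    (1 / (N : ℝ)) * ∑ i, M.r (x.2 i) (z.2 i)

variable (M : SingleArmedMDP S) (y : S → Bool → ℝ≥0) {B : ℕ} (hB : B ≤ N)
    (F : FocusRule S N α μ) (s₀ : Fin N → S)

theorem setExpansionPolicy_act_eq (D' : Finset (Fin N))
    (s : Fin N → S) : (setExpansionPolicy y hB F).act D' s
      = (F.choose s D').bind fun D => (focusActions y hB s D).map fun z => (D, z.2) := by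
  simp only [setExpansionPolicy, focusActions, PMF.map_bind, PMF.map_comp, Function.comp_def]

theorem stateLaw_eq_focusChain (t : ℕ) :
    stateLaw M (setExpansionPolicy y hB F) s₀ t = focusChain M y hB F s₀ t := by
  induction t with
  | zero => rfl
  | succ t ih =>
    rw [stateLaw, ih, focusChain]
    refine congrArg _ (funext fun x : Finset (Fin N) × (Fin N → S) => ?_)
    refine (congrArg (fun p : PMF (Finset (Fin N) × (Fin N → Bool)) => p.bind fun z =>
      (indepLaw fun i => M.P (x.2 i) (z.2 i)).map fun s' => (z.1, s'))
      (setExpansionPolicy_act_eq y hB F x.1 x.2)).trans ?_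
    simp only [focusStep, PMF.bind_bind, PMF.bind_map, Function.comp_def]

theorem stateActionLaw_eq (t : ℕ) :
    stateActionLaw M (setExpansionPolicy y hB F) s₀ t
      = (focusChain M y hB F s₀ t).bind fun x => (F.choose x.2 x.1).bind fun D =>
          (focusActions y hB x.2 D).map fun z => (x.2, z.2) := by
  rw [stateActionLaw, stateLaw_eq_focusChain]
  refine congrArg _ (funext fun x : Finset (Fin N) × (Fin N → S) => ?_)
  refine (congrArg (fun p : PMF (Finset (Fin N) × (Fin N → Bool)) => p.map fun z => (x.2, z.2))
    (setExpansionPolicy_act_eq y hB F x.1 x.2)).trans ?_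
  simp only [PMF.map_bind, PMF.map_comp, Function.comp_def]

theorem expectedReward_eq_focusReward (t : ℕ) :
    expectedReward M (setExpansionPolicy y hB F) s₀ t
      = mean (focusChain M y hB F s₀ t) (focusReward M y hB F) := by
  rw [expectedReward_eq_mean, stateActionLaw_eq]
  simp only [mean_bind, mean_map]
  rfl

theorem pulls_of_mem_rectifiedActions {D : Finset (Fin N)} {b a : Fin N → Bool}
    (ha : a ∈ rectifiedActions B D b) : pulls Finset.univ a = B := by
  unfold rectifiedActions at ha
  split_ifs at ha <;> simp only [Finset.mem_filter, Finset.mem_univ, true_and] at ha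
  exacts [ha.1, ha.1, ha.1.1]

theorem setExpansionPolicy_satisfiesBudget :
    SatisfiesBudget M (setExpansionPolicy y hB F) s₀ B := by
  intro t x hx
  rw [stateActionLaw_eq, PMF.mem_support_bind_iff] at hx
  obtain ⟨w, _, hx⟩ := hx
  rw [PMF.mem_support_bind_iff] at hx
  obtain ⟨D, _, hx⟩ := hx
  rw [PMF.mem_support_map_iff] at hx
  obtain ⟨z, hz, rfl⟩ := hx
  exact pulls_of_mem_rectifiedActions (mem_rectifiedActions_of_mem_support hz)

/-- The transition operator of the chain of focus sets and state vectors. -/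
noncomputable def focusOperator :
    (Finset (Fin N) × (Fin N → S) → ℝ) →ₗ[ℝ] (Finset (Fin N) × (Fin N → S) → ℝ) where
  toFun f x := mean (focusStep M y hB F x) f
  map_add' f g := funext fun _ => mean_add _ f g
  map_smul' c f := funext fun _ => mean_const_mul _ c f

theorem norm_focusOperator_le (f : Finset (Fin N) × (Fin N → S) → ℝ) :
    ‖focusOperator M y hB F f‖ ≤ ‖f‖ := by
  refine (pi_norm_le_iff_of_nonneg (norm_nonneg f)).2 fun _ => ?_
  exact (abs_mean_le _ _).trans (mean_le_of_forall fun z _ => norm_le_pi_norm f z)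

theorem norm_focusOperator_pow_le (n : ℕ) (f : Finset (Fin N) × (Fin N → S) → ℝ) :
    ‖(focusOperator M y hB F ^ n) f‖ ≤ ‖f‖ := by
  induction n with
  | zero => simp
  | succ n ih =>
    rw [pow_succ', Module.End.mul_apply]
    exact (norm_focusOperator_le M y hB F _).trans ih

theorem mean_focusChain_succ (t : ℕ) (f : Finset (Fin N) × (Fin N → S) → ℝ) :
    mean (focusChain M y hB F s₀ (t + 1)) f
      = mean (focusChain M y hB F s₀ t) (focusOperator M y hB F f) := by
  rw [focusChain, mean_bind]
  rfl

theorem mean_focusChain (t : ℕ) (f : Finset (Fin N) × (Fin N → S) → ℝ) :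
    mean (focusChain M y hB F s₀ t) f = (focusOperator M y hB F ^ t) f (∅, s₀) := by
  induction t generalizing f with
  | zero => simp [focusChain, mean_pure]
  | succ t ih => rw [mean_focusChain_succ, ih, pow_succ, Module.End.mul_apply]

/-- The long-run average reward of the set-expansion policy exists. -/
theorem exists_tendsto_averageReward :
    ∃ R, Tendsto (averageReward M (setExpansionPolicy y hB F) s₀) atTop (𝓝 R) := by
  obtain ⟨z, hz⟩ := exists_tendsto_average_pow (focusOperator M y hB F)
    (norm_focusOperator_pow_le M y hB F) (focusReward M y hB F)
  refine ⟨z (∅, s₀), (tendsto_pi_nhds.1 hz (∅, s₀)).congr fun T => ?_⟩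
  simp only [averageReward, expectedReward_eq_focusReward, mean_focusChain, Pi.smul_apply,
    Finset.sum_apply, smul_eq_mul]

/-- A Foster–Lyapunov inequality bounds the long-run average reward from below. -/
theorem sub_le_of_drift {V : Finset (Fin N) × (Fin N → S) → ℝ} (hV : ∀ x, 0 ≤ V x) {c K v R : ℝ}
    (hc : 0 ≤ c)
    (hdrift : ∀ x, v - focusReward M y hB F x ≤ c * (V x - focusOperator M y hB F V x) + K)
    (hR : Tendsto (averageReward M (setExpansionPolicy y hB F) s₀) atTop (𝓝 R)) :
    v - R ≤ K := by
  have hstep : ∀ t, v - expectedReward M (setExpansionPolicy y hB F) s₀ t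
      ≤ c * (mean (focusChain M y hB F s₀ t) V - mean (focusChain M y hB F s₀ (t + 1)) V) + K :=
    fun t => by
    have h := mean_mono (p := focusChain M y hB F s₀ t) fun x _ => hdrift x
    rw [mean_sub, mean_add, mean_const_mul, mean_sub, mean_const, mean_const] at h
    rwa [expectedReward_eq_focusReward, mean_focusChain_succ]
  -- The drift telescopes; the final value of `V` is dropped by nonnegativity and the initial one
  -- disappears after division by `T`.
  have havg : ∀ T : ℕ, 0 < T → v - c * mean (focusChain M y hB F s₀ 0) V * (1 / (T : ℝ)) - K
      ≤ averageReward M (setExpansionPolicy y hB F) s₀ T := fun T hT => by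
    have hT' : (0 : ℝ) < T := Nat.cast_pos.2 hT
    have h := Finset.sum_le_sum fun t (_ : t ∈ Finset.range T) => hstep t
    rw [Finset.sum_add_distrib, ← Finset.mul_sum,
      Finset.sum_range_sub' fun t => mean (focusChain M y hB F s₀ t) V, Finset.sum_sub_distrib] at h
    simp only [Finset.sum_const, Finset.card_range, nsmul_eq_mul] at h
    have hpos : 0 ≤ mean (focusChain M y hB F s₀ T) V := le_mean_of_forall fun x _ => hV x
    have h1 := mul_nonneg hc hpos
    have h2 : (T : ℝ) * (v - c * mean (focusChain M y hB F s₀ 0) V * (1 / (T : ℝ)) - K)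
        ≤ ∑ t ∈ Finset.range T, expectedReward M (setExpansionPolicy y hB F) s₀ t := by
      have h3 : (T : ℝ) * (v - c * mean (focusChain M y hB F s₀ 0) V * (1 / (T : ℝ)) - K)
          = T * v - c * mean (focusChain M y hB F s₀ 0) V - T * K := by
        field_simp
      rw [h3]
      linarith
    rw [averageReward, one_div (T : ℝ), le_inv_mul_iff₀ hT', ← one_div]
    exact h2
  have hlim : Tendsto (fun T : ℕ => v - c * mean (focusChain M y hB F s₀ 0) V * (1 / (T : ℝ)) - K)
      atTop (𝓝 (v - K)) := by
    have h := ((tendsto_one_div_atTop_nhds_zero_nat (𝕜 := ℝ)).const_mul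
      (c * mean (focusChain M y hB F s₀ 0) V)).const_sub v
    simpa using h.sub_const K
  have hle := le_of_tendsto_of_tendsto hlim hR
    ((eventually_gt_atTop 0).mono fun T hT => havg T hT)
  linarith

/-- The real supremum of the empty set is `0`, so a policy `π` within the budget is needed as a
witness; the set-expansion policy will provide it. -/
theorem optimalReward_le_lpObjective {M : SingleArmedMDP S} {y : S → Bool → ℝ≥0} (hN : 0 < N)
    (hBα : (B : ℝ) = α * N) (hy : LPOptimal M α y) {π : Policy S N}
    (hπ : SatisfiesBudget M π s₀ B) : optimalReward M N B s₀ ≤ lpObjective M y := by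
  refine csSup_le ⟨_, π, hπ, rfl⟩ ?_
  rintro _ ⟨π', hπ', rfl⟩
  exact liminfReward_le_lpObjective hN hBα hy hπ'

end FocusChain

end RestlessBandit

theorem theorem1 {S : Type*} [Fintype S] [DecidableEq S]
    (M : SingleArmedMDP S) (α : ℝ) (hα0 : 0 < α) (hα1 : α < 1)
    (y : S → Bool → ℝ≥0) (hy : LPOptimal M α y)
    (hchain : IsAperiodicUnichain (armMatrix M y))
    (μ : S → ℝ) (hμ : IsStationaryDistribution (armMatrix M y) μ) :
    Summable (weightTerm (armMatrix M y) μ) ∧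
    ∃ lam : ℝ, IsMaxEigenvalue (weightMatrix (armMatrix M y) μ) lam ∧
      ∀ (N : ℕ) (_ : 0 < N) (B : ℕ) (hB : (B : ℝ) = α * N) (s₀ : Fin N → S)
        (F : FocusRule S N α μ),
        ∃ R : ℝ,
          Tendsto (averageReward M (setExpansionPolicy y (budget_le hα1 hB) F) s₀) atTop (𝓝 R) ∧
          optimalReward M N B s₀ - R ≤
            252 * M.rmax * lam ^ 2 * (Fintype.card S : ℝ) ^ 2 / (min α (1 - α)) ^ 2
              / Real.sqrt N := by
  have hs := summable_weightTerm (armMatrix_mem_rowStochastic M y) hchain hμ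
  have : Nonempty S := by
    by_contra hempty
    rw [not_nonempty_iff] at hempty
    have := hμ.total
    simp at this
  obtain ⟨lam, hlam, h, hh⟩ := exists_weightedNorm hs
  refine ⟨hs, lam, hlam, fun N hN B hB s₀ F => ?_⟩
  have hfac := hy.1.eq_mul_armProb hchain hμ
  have hbudget : ∑ x, μ x * (armProb y x true : ℝ) = α := by
    rw [← hy.1.budget]
    exact Finset.sum_congr rfl fun x _ => (hfac x true).symm
  have hβ0 : 0 < min α (1 - α) := lt_min hα0 (by linarith)
  have hr := rmax_nonneg M
  have hlam1 := hh.one_le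
  obtain ⟨R, hR⟩ := exists_tendsto_averageReward M y (budget_le hα1 hB) F s₀
  refine ⟨R, hR, ?_⟩
  have hopt := optimalReward_le_lpObjective s₀ hN hB hy
    (setExpansionPolicy_satisfiesBudget M y (budget_le hα1 hB) F s₀)
  have hloss := sub_le_of_drift M y (budget_le hα1 hB) F s₀
    (lyapunov_nonneg hh hα0 hα1 μ)
    (c := 3 * M.rmax * Fintype.card S * lam / min α (1 - α)) (v := lpObjective M y)
    (K := 252 * M.rmax * lam ^ 2 * (Fintype.card S : ℝ) ^ 2 / (min α (1 - α)) ^ 2 / Real.sqrt N)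
    (by positivity) (fun x => ?_) hR
  · linarith
  · have hstep := mean_mono (p := F.choose x.2 x.1) fun D hD =>
      (F.valid x.2 x.1 D hD).lpObjective_sub_le hh hN hα0 hα1 hB (budget_le hα1 hB) hμ hfac hbudget
    simp only [mean_sub, mean_add, mean_const_mul, mean_const] at hstep
    have hop : focusOperator M y (budget_le hα1 hB) F (lyapunov α μ lam h) x
        = mean (F.choose x.2 x.1) fun D => mean (focusActions y (budget_le hα1 hB) x.2 D) fun z =>
            mean (indepLaw fun i => M.P (x.2 i) (z.2 i)) fun s' => lyapunov α μ lam h (D, s') := by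
      simp only [focusOperator, LinearMap.coe_mk, AddHom.coe_mk, focusStep, mean_bind, mean_map]
    rw [hop, focusReward]
    simp only [mean_const_mul]
    exact hstep
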